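/- **Setting.** Let $\mathcal A_0[\|\cdot\|_0]$ be a unital complex $C^*$-normed algebra with completion $C$ (a $C^*$-algebra with positive cone $C_+$). Let $\tau$ be a Hausdorff locally convex topology on $\mathcal A_0$ given by a directed family of seminorms $(p_\lambda)_{\lambda\in\Lambda}$, such that the involution is $\tau$-continuous, the multiplication is separately $\tau$-continuous, $\tau$ is coarser than $\|\cdot\|_0$, and every $\|\cdot\|_0$-Cauchy net in $\mathcal A_0$ that $\tau$-converges to $0$ converges to $0$ in norm. Let $X$ be the $\tau$-completion of $\mathcal A_0$, so that $\mathcal A_0\subset C\subset X$; the involution of $\mathcal A_0$ and the multiplications by elements of $\mathcal A_0$ extend continuously to $X$. Put $(\mathcal A_0)_+=\{x\in\mathcal A_0: x^*=x,\ \mathrm{sp}_{\mathcal A_0}(x)\subset[0,\infty)\}$; an element of $X$ is *quasi-positive* if it is a $\tau$-limit of a net in $(\mathcal A_0)_+$, and *commutatively quasi-positive* if it is a $\tau$-limit of a net of pairwise commuting elements of $(\mathcal A_0)_+$. Assume further: * for every $\lambda$ there are $\lambda'$ and $\gamma>0$ with $p_\lambda(xy)\le\gamma\|x\|_0\,p_{\lambda'}(y)$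 for all $x,y\in\mathcal A_0$ with $xy=yx$; * $\{x\in C_+:\|x\|_0\le1\}$ is $\tau$-closed in $X$; * the quasi-positive elements of $X$ that lie in $C$ are exactly the elements of $C_+$. Let $\mathcal A[\tau]$ be a locally convex quasi $C^*$-normed algebra over $\mathcal A_0$, i.e. a $*$-invariant linear subspace of $X$ that contains $C$ and is stable under left and right multiplication by elements of $\mathcal A_0$. Let $a\in\mathcal A$ be commutatively quasi-positive. **Notions.** An inverse $(1+a)^{-1}$ is an element $y\in C$ for which there is a net of pairwise commuting elements $x_\alpha\in(\mathcal A_0)_+$, each commuting with $y$, with $x_\alpha\to a$, $(1+x_\alpha)y\to1$ and $(1+x_\alpha)^{-1}\to y$ in $\tau$. Given such an inverse, $C^*(a)$ is the closed $*$-subalgebra of $C$ generated by $1$ and $(1+a)^{-1}$; it is commutative. For $b$ in the $\tau$-closure of $C^*(a)$ and $z\in C^*(a)$, $b\cdot z=\tau\text{-}\lim x_\alpha z$ for nets $x_\alpha\in C^*(a)$ with $x_\alpha\to b$. The spectrum $\sigma=\sigma_{C^*(a)}(a)\subset\mathbb C\cup\{\infty\}$ consists of the $\lambda\in\mathbb C$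 for which there is no $z\in C^*(a)$ with $(\lambda1-a)\cdot z=1$, together with $\infty$ if $a\notin C^*(a)$. Let $\mathcal C_b(\sigma)$ be the $C^*$-algebra of bounded continuous complex functions on $\sigma$, a subspace of the one-point compactification $\mathbb C\cup\{\infty\}$. For $k\ge0$ let $\mathcal C_k(\sigma)$ be the set of functions $f:\sigma\cap\mathbb C\to\mathbb C$ of the form $f(\lambda)=(1+\lambda)^kg(\lambda)$ with $g\in\mathcal C_b(\sigma)$; so $\mathcal C_0(\sigma)$ consists of the restrictions of the elements of $\mathcal C_b(\sigma)$ to $\sigma\cap\mathbb C$. For $b,c\in\mathcal A$, $b$ is a left multiplier of $c$ with product $bc=d\in\mathcal A$ if there are nets $x_\alpha\to b$, $y_\beta\to c$ in $C^*(a)\cap C_+$ whose doubly indexed net of products $x_\alpha y_\beta$ $\tau$-converges to $d$; and then, for $x,z\in C^*(a)$, $(b\cdot x)(c\cdot z):=(bc)\cdot(xz)$. That $a^n$ is well defined means that, starting from $a^0=1$, $a$ is a left multiplier of $a^{k}$ with product $a^{k+1}$ for all $0\le k<n$. Finally $\mathcal A\cdot C^*(a)$ is the linear span of the elements $\tau\text{-}\lim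 x_\alpha z$, where $z\in C^*(a)$ and $(x_\alpha)$ is a net in $C$ of elements commuting with $z$, $\tau$-converging to an element of $\mathcal A$, such that $(x_\alpha z)$ is $\tau$-convergent. **Theorem.** An inverse $(1+a)^{-1}$ exists. For each such inverse and each $n\ge1$ for which $a^n$ is well defined, there is a unique map $f\mapsto f(a)$ from $\bigcup_{k=1}^n\mathcal C_k(\sigma)$ into $\mathcal A\cdot C^*(a)$ which is injective, satisfies $\bar f(a)=f(a)^*$, and has the following properties. 1. If $u_0(\lambda)=1$ for all $\lambda$, then $u_0(a)=1$. 2. If $u_1(\lambda)=\lambda$ for all $\lambda$, then $u_1(a)=a$. 3. $(\lambda_1f_1+f_2)(a)=\lambda_1f_1(a)+f_2(a)$ for all $f_1,f_2\in\bigcup_{k=1}^n\mathcal C_k(\sigma)$ and $\lambda_1\in\mathbb C$; and for $f_j\in\mathcal C_{k_j}(\sigma)$, $k_j\ge0$, $k_1+k_2\le n$, the product $f_1(a)f_2(a)$ is well defined and equal to $(f_1f_2)(a)$. 4. Restricted to the bounded continuous functions, $f\mapsto f(a)$ is an isometric $*$-isomorphism of the $C^*$-algebra $\mathcal C_b(\sigma)$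 onto $C^*(a)$. -/

import Mathlib

open Filter Topology BoundedContinuousFunction

namespace QuasiCStar

/-- A unital `C*`-normed algebra `A₀`, its norm completion `C`, a locally convex topology `τ` on
`A₀`, and the `τ`-completion `X` of `A₀`.

* `A₀` is a dense `*`-subalgebra of the `C*`-algebra `C`; equivalently, `A₀` is a unital
  `C*`-normed algebra and `C` is its completion.
* `τ` is the topology that the directed family of seminorms `p` defines. The seminorms are given
  on the completion `X` (a complete Hausdorff locally convex space in which `A₀` is dense);
  `x ↦ p l (ι x)` is the corresponding seminorm on `A₀`.
* `A₀` with `τ` is a locally convex `*`-algebra with separately continuous multiplication, so the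
  involution and the multiplications by elements of `A₀` extend continuously to `X`. The extended
  involution is the star of `X`, the extended multiplications are `lmul` and `rmul`.
* `τ` is coarser than the norm topology and compatible with it. The map `ι : C → X` is the
  continuous extension of the inclusion of `A₀` in `X`. -/
structure TauCompletion (C X Λ : Type*) [CStarAlgebra C]
    [AddCommGroup X] [Module ℂ X] [UniformSpace X] [IsUniformAddGroup X] [ContinuousSMul ℂ X]
    [CompleteSpace X] [T2Space X] [StarAddMonoid X] [StarModule ℂ X] [ContinuousStar X] where
  /-- The `C*`-normed algebra, inside its norm completion. -/
  A₀ : StarSubalgebra ℂ C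
  dense_A₀ : Dense (A₀ : Set C)
  /-- The defining family of seminorms of `τ`. -/
  p : SeminormFamily ℂ X Λ
  directed_p : Directed (· ≤ ·) p
  withSeminorms_p : WithSeminorms p
  /-- The canonical map of the norm completion in the `τ`-completion. -/
  ι : C →ₗ[ℂ] X
  dense_image : Dense (ι '' (A₀ : Set C))
  /-- `τ` is coarser than the norm topology. -/
  continuous_ι : Continuous ι
  /-- A norm-Cauchy net in `A₀` which `τ`-converges to `0` norm-converges to `0`. -/
  compatible : ∀ F : Filter C, Cauchy F → (A₀ : Set C) ∈ F →
    Tendsto ι F (𝓝 0) → Tendsto (fun x : C => x) F (𝓝 0)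
  star_ι : ∀ x ∈ A₀, ι (star x) = star (ι x)
  /-- Multiplication `b ↦ x b` of `X` by `x` in `A₀`. -/
  lmul : A₀ → X →L[ℂ] X
  lmul_ι : ∀ x y : A₀, lmul x (ι y) = ι (x * y)
  /-- Multiplication `b ↦ b x` of `X` by `x` in `A₀`. -/
  rmul : A₀ → X →L[ℂ] X
  rmul_ι : ∀ x y : A₀, rmul x (ι y) = ι (y * x)

variable {C X Λ : Type*} [CStarAlgebra C] [PartialOrder C] [StarOrderedRing C]
  [AddCommGroup X] [Module ℂ X] [UniformSpace X] [IsUniformAddGroup X] [ContinuousSMul ℂ X]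
  [CompleteSpace X] [T2Space X] [StarAddMonoid X] [StarModule ℂ X] [ContinuousStar X]

namespace TauCompletion

/-- `(A₀)₊`: the self-adjoint elements of `A₀` whose spectrum in the algebra `A₀` lies
in `[0, ∞)`. -/
def posA₀ (S : TauCompletion C X Λ) : Set S.A₀ :=
  {x | IsSelfAdjoint x ∧ ∀ z ∈ spectrum ℂ x, ∃ r : ℝ, 0 ≤ r ∧ z = (r : ℂ)}

/-- The quasi-positive elements of `X`: the `τ`-limits of nets in `(A₀)₊`. -/
def quasiPos (S : TauCompletion C X Λ) : Set X :=
  closure ((fun x : S.A₀ => S.ι x) '' S.posA₀)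

/-- The commutatively quasi-positive elements of `X`: the `τ`-limits of nets of pairwise
commuting elements of `(A₀)₊`. -/
def commQuasiPos (S : TauCompletion C X Λ) : Set X :=
  {a | ∃ T : Set S.A₀, T ⊆ S.posA₀ ∧ (∀ x ∈ T, ∀ y ∈ T, x * y = y * x) ∧
    a ∈ closure ((fun x : S.A₀ => S.ι x) '' T)}

/-- `b` in `X` and `z` in `C` commute strongly and `b · z = w`: there is a net in `C` of elements
commuting with `z` which `τ`-converges to `b`, and its products with `z` `τ`-converge to `w`. -/
def StrongMul (S : TauCompletion C X Λ) (b : X) (z : C) (w : X) : Prop :=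
  ∃ F : Filter C, F.NeBot ∧ (∀ᶠ x in F, x * z = z * x) ∧
    Tendsto S.ι F (𝓝 b) ∧ Tendsto (fun x => S.ι (x * z)) F (𝓝 w)

end TauCompletion

/-- A locally convex quasi `C*`-normed algebra over `A₀`: a quasi `*`-subalgebra of the
`τ`-completion `X` which contains the norm completion `C`, where `τ` satisfies the three
further conditions `mul_bound`, `closed_ball` and `quasiPos_inter`. -/
structure QuasiCStarNormedAlgebra (S : TauCompletion C X Λ) where
  carrier : Submodule ℂ X
  star_mem : ∀ b ∈ carrier, star b ∈ carrier
  lmul_mem : ∀ (x : S.A₀), ∀ b ∈ carrier, S.lmul x b ∈ carrier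
  rmul_mem : ∀ (x : S.A₀), ∀ b ∈ carrier, S.rmul x b ∈ carrier
  ι_mem : ∀ z : C, S.ι z ∈ carrier
  mul_bound : ∀ l : Λ, ∃ l' : Λ, ∃ γ : ℝ, 0 < γ ∧ ∀ x y : S.A₀, x * y = y * x →
    S.p l (S.ι (x * y)) ≤ γ * ‖x‖ * S.p l' (S.ι y)
  /-- The positive part of the unit ball of `C` is `τ`-closed in `X`. -/
  closed_ball : IsClosed (S.ι '' {x : C | 0 ≤ x ∧ ‖x‖ ≤ 1})
  quasiPos_inter : S.quasiPos ∩ Set.range S.ι = S.ι '' {x : C | 0 ≤ x}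

namespace TauCompletion

/-- `y` in `C` is the inverse of `1 + a`, for a commutatively quasi-positive `a`: for some net of
pairwise commuting elements `x` of `(A₀)₊` which commute with `y` and `τ`-converge to `a`,
the products `(1 + x) y = y (1 + x)` converge to `1`, that is `(1 + a) · y = y · (1 + a) = 1`,
and the inverses `(1 + x)⁻¹` converge to `y`. -/
def IsInvOneAdd (S : TauCompletion C X Λ) (a : X) (y : C) : Prop :=
  ∃ F : Filter S.A₀, F.NeBot ∧
    (∃ T ∈ F, T ⊆ S.posA₀ ∧ (∀ x ∈ T, ∀ x' ∈ T, x * x' = x' * x) ∧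
      ∀ x ∈ T, (x : C) * y = y * x) ∧
    Tendsto (fun x : S.A₀ => S.ι x) F (𝓝 a) ∧
    Tendsto (fun x : S.A₀ => S.ι ((1 + (x : C)) * y)) F (𝓝 (S.ι 1)) ∧
    Tendsto (fun x : S.A₀ => S.ι (Ring.inverse (1 + (x : C)))) F (𝓝 (S.ι y))

/- In the following definitions `B` is a commutative `C*`-subalgebra of `C` containing `1`. -/

/-- The product `b · z = w` of `z` in `B` with an element `b` of the `τ`-closure of `B`:
`w` is the `τ`-limit of the products `x z` along a net in `B` which `τ`-converges to `b`. -/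
def MulBy (S : TauCompletion C X Λ) (B : StarSubalgebra ℂ C) (b : X) (z : C) (w : X) : Prop :=
  z ∈ B ∧ ∃ F : Filter C, F.NeBot ∧ (B : Set C) ∈ F ∧
    Tendsto S.ι F (𝓝 b) ∧ Tendsto (fun x => S.ι (x * z)) F (𝓝 w)

/-- The spectrum of `a` with respect to `B`, a subset of `ℂ ∪ {∞}`: a complex number `l` belongs
to it if and only if `l 1 - a` has no inverse in `B`, and `∞` if and only if `a` is not
in `B`. -/
def spec (S : TauCompletion C X Λ) (B : StarSubalgebra ℂ C) (a : X) : Set (OnePoint ℂ) :=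
  {t | (∃ l : ℂ, t = (l : OnePoint ℂ) ∧ ¬ ∃ z : C, S.MulBy B (l • S.ι 1 - a) z (S.ι 1)) ∨
    (t = OnePoint.infty ∧ a ∉ S.ι '' (B : Set C))}

/-- `b` is a left multiplier of `c` and `b c = d`, in the quasi `*`-algebra `A`:
there are nets `x` and `x'` of positive elements of `B` which `τ`-converge to `b` and to `c`
(in particular `b` and `c` are quasi-positive over `B`), and the doubly indexed net of the
products `x x'` `τ`-converges to `d`. -/
def LeftMul (S : TauCompletion C X Λ) (A : Submodule ℂ X) (B : StarSubalgebra ℂ C)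
    (b c d : X) : Prop :=
  b ∈ A ∧ c ∈ A ∧ d ∈ A ∧ ∃ F G : Filter C, F.NeBot ∧ G.NeBot ∧
    {x : C | x ∈ B ∧ 0 ≤ x} ∈ F ∧ {x : C | x ∈ B ∧ 0 ≤ x} ∈ G ∧
    Tendsto S.ι F (𝓝 b) ∧ Tendsto S.ι G (𝓝 c) ∧
    Tendsto (fun q : C × C => S.ι (q.1 * q.2)) (F ×ˢ G) (𝓝 d)

/-- `w` is the power `a ^ k`: `a ^ 0 = 1`, and `a ^ (k + 1)` is the product of `a` with `a ^ k`,
where `a` has to be a left multiplier of `a ^ k`. -/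
def IsPow (S : TauCompletion C X Λ) (A : Submodule ℂ X) (B : StarSubalgebra ℂ C) (a : X) :
    ℕ → X → Prop
  | 0, w => w = S.ι 1
  | k + 1, w => ∃ v, S.IsPow A B a k v ∧ S.LeftMul A B a v w

/-- `w` is a value of the product of `u = b · x` and `v = c · z`, where `x` and `z` are in `B`
and `b` is a left multiplier of `c`: `(b · x) (c · z) = (b c) · (x z)`. -/
def ProdValue (S : TauCompletion C X Λ) (A : Submodule ℂ X) (B : StarSubalgebra ℂ C)
    (u v w : X) : Prop :=
  ∃ (b c d : X) (x z : C), S.LeftMul A B b c d ∧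
    S.MulBy B b x u ∧ S.MulBy B c z v ∧ S.MulBy B d (x * z) w

/-- The product of `u` and `v` is well defined and equal to `w`. -/
def HasProd (S : TauCompletion C X Λ) (A : Submodule ℂ X) (B : StarSubalgebra ℂ C)
    (u v w : X) : Prop :=
  S.ProdValue A B u v w ∧ ∀ w', S.ProdValue A B u v w' → w' = w

/-- `A · B`: the linear span of the products `b · z` of strongly commuting `b` in `A`
and `z` in `B`. -/
def mulSpan (S : TauCompletion C X Λ) (A : Submodule ℂ X) (B : StarSubalgebra ℂ C) :
    Submodule ℂ X :=
  Submodule.span ℂ {w | ∃ b ∈ A, ∃ z ∈ B, S.StrongMul b z w}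

end TauCompletion

/-- The complex numbers in a subset of `ℂ ∪ {∞}`. -/
abbrev FinPart (σ : Set (OnePoint ℂ)) : Type := {l : ℂ // (l : OnePoint ℂ) ∈ σ}

/-- The functions `f` on the finite part of `σ ⊆ ℂ ∪ {∞}` such that `f l / (1 + l) ^ k` is the
restriction of a bounded continuous function on `σ` (with `∞`, if `∞ ∈ σ`). For `k = 0` these
are the restrictions of the bounded continuous functions on `σ`. -/
def Ck (σ : Set (OnePoint ℂ)) (k : ℕ) : Set (FinPart σ → ℂ) :=
  {f | ∃ g : σ →ᵇ ℂ, ∀ l : FinPart σ, f l = (1 + (l : ℂ)) ^ k * g ⟨(l : OnePoint ℂ), l.2⟩}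

/-- The union of the sets `Ck σ k` over `1 ≤ k ≤ n`. -/
def CkUnion (σ : Set (OnePoint ℂ)) (n : ℕ) : Set (FinPart σ → ℂ) :=
  {f | ∃ k, 1 ≤ k ∧ k ≤ n ∧ f ∈ Ck σ k}

/-- `Φ`, to be thought of as `f ↦ f(a)`, is a `*`-isomorphism from the union of the
`Ck σ k`, `1 ≤ k ≤ n`, where `σ` is the spectrum of `a` with respect to `B`, into `A · B`,
with the properties of a functional calculus of `a`. -/
structure IsFunctionalCalculus (S : TauCompletion C X Λ) (A : Submodule ℂ X)
    (B : StarSubalgebra ℂ C) (a : X) (n : ℕ) (Φ : CkUnion (S.spec B a) n → X) : Prop where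
  mem_mulSpan : ∀ f, Φ f ∈ S.mulSpan A B
  injective : Function.Injective Φ
  map_star : ∀ f : CkUnion (S.spec B a) n,
    ∃ h : star (f : FinPart (S.spec B a) → ℂ) ∈ CkUnion (S.spec B a) n, Φ ⟨_, h⟩ = star (Φ f)
  map_one : ∃ h : (fun _ : FinPart (S.spec B a) => (1 : ℂ)) ∈ CkUnion (S.spec B a) n, Φ ⟨_, h⟩ = S.ι 1
  map_id : ∃ h : (fun l : FinPart (S.spec B a) => (l : ℂ)) ∈ CkUnion (S.spec B a) n,
    Φ ⟨_, h⟩ = a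
  map_linear : ∀ (c : ℂ) (f g : CkUnion (S.spec B a) n),
    ∃ h : c • (f : FinPart (S.spec B a) → ℂ) + g ∈ CkUnion (S.spec B a) n,
      Φ ⟨_, h⟩ = c • Φ f + Φ g
  map_mul : ∀ (j k : ℕ) (f g : CkUnion (S.spec B a) n),
    (f : FinPart (S.spec B a) → ℂ) ∈ Ck (S.spec B a) j →
    (g : FinPart (S.spec B a) → ℂ) ∈ Ck (S.spec B a) k → j + k ≤ n →
    ∃ h : (f : FinPart (S.spec B a) → ℂ) * g ∈ CkUnion (S.spec B a) n,
      S.HasProd A B (Φ f) (Φ g) (Φ ⟨_, h⟩)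
  /-- On the bounded continuous functions on the spectrum, `Φ` is an isometric `*`-isomorphism
  onto `B`. -/
  bounded : ∃ Ψ : (S.spec B a →ᵇ ℂ) ≃⋆ₐ[ℂ] B, Isometry Ψ ∧ ∀ g : S.spec B a →ᵇ ℂ,
    ∃ h : (fun l : FinPart (S.spec B a) => g ⟨_, l.2⟩) ∈ CkUnion (S.spec B a) n, Φ ⟨_, h⟩ = S.ι (Ψ g : C)

end QuasiCStar

/-! Put `y = (1 + a)⁻¹` and `K = spectrum ℂ y`, a subset of `[0, 1]`. Then `C*(a)` is `C(K)`, and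
with `t` the identity function of `K` the element `a` plays the part of `1/t - 1`. If `0 ∈ K` this
is no element of `C(K)`, but it lies in the `τ`-closure `Y` of `C*(a)`, where one computes by
clearing denominators.

The inverse is the limit of the resolvents `(1 + x)⁻¹`: by the resolvent identity and `mul_bound`
they form a `τ`-Cauchy net in the positive unit ball, which is `τ`-closed (`exists_isInvOneAdd`).

The inequality `mul_bound` speaks of `A₀`, whereas `y` is only in `C`. It extends to a norm-closed
commutative algebra containing the resolvents, and passes to functions of `y` because `f((1 + x)⁻¹)
→ f(y)` in `τ` (`IsCalculusNet.tendsto`). Thus `Y` becomes a module over `C(K)`. The decisive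
analytic fact is that `1 / (1 + (m + 1) t) → 0` in `τ` (`IsCalculusNet.tendsto_damping_mul`), even
when the norms do not tend to `0`. It makes multiplication by `t` injective on `Y`
(`eq_zero_of_act_idFun`), and a similar estimate gives `a ∈ Y` with `t a = 1 - t`.

If `a ^ n` exists, the binomial formula yields `c k = (1 + a) ^ k` in `A` with `t ^ k c k = 1` for
`k ≤ n`. For `f = (1 + λ) ^ k g`, with `g` read as a function of `t = 1 / (1 + λ)`, the value `f(a)
= g · c k` is the only `b` in `Y` with `t ^ k b = g`. The algebraic properties thereby reduce to
identities in `C(K)`. For uniqueness, multiplicativity forces `1 / (1 + λ)` to go to `y`; this fixes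
the bounded functions, and then `t ^ n f(a)` for every `f`. -/

namespace QuasiCStar

variable {C X Λ : Type*} [CStarAlgebra C] [PartialOrder C] [StarOrderedRing C]
  [AddCommGroup X] [Module ℂ X] [UniformSpace X] [IsUniformAddGroup X] [ContinuousSMul ℂ X]
  [CompleteSpace X] [T2Space X] [StarAddMonoid X] [StarModule ℂ X] [ContinuousStar X]

set_option linter.unusedSectionVars false

namespace TauCompletion

/-! ### The norm completion inside the `τ`-completion. -/

section Embedding

variable (S : TauCompletion C X Λ)

/-- If `ι c = 0`, the trace on `A₀` of the norm neighbourhoods of `c` is a Cauchy filter that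
`τ`-converges to `0`; by compatibility its norm limit `c` is `0`. -/
theorem ι_injective : Function.Injective S.ι := by
  refine (injective_iff_map_eq_zero S.ι).2 fun c hc => ?_
  have hne : (𝓝[(S.A₀ : Set C)] c).NeBot := mem_closure_iff_nhdsWithin_neBot.1 (S.dense_A₀ c)
  have hle : 𝓝[(S.A₀ : Set C)] c ≤ 𝓝 c := nhdsWithin_le_nhds
  have h := S.compatible (𝓝[(S.A₀ : Set C)] c) (cauchy_nhds.mono hle) self_mem_nhdsWithin
    (hc ▸ (S.continuous_ι.tendsto c).mono_left hle)
  exact tendsto_nhds_unique (tendsto_id.mono_left hle) h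

theorem ι_star (c : C) : S.ι (star c) = star (S.ι c) := by
  have h : Set.EqOn (fun c => S.ι (star c)) (fun c => star (S.ι c)) (S.A₀ : Set C) := S.star_ι
  exact congrFun (Continuous.ext_on S.dense_A₀ (S.continuous_ι.comp continuous_star)
    (continuous_star.comp S.continuous_ι) h) c

theorem lmul_ι_apply (x : S.A₀) (c : C) : S.lmul x (S.ι c) = S.ι (x * c) := by
  have h : Set.EqOn (fun c => S.lmul x (S.ι c)) (fun c => S.ι (x * c)) (S.A₀ : Set C) :=
    fun c hc => S.lmul_ι x ⟨c, hc⟩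
  exact congrFun (Continuous.ext_on S.dense_A₀ ((S.lmul x).continuous.comp S.continuous_ι)
    (S.continuous_ι.comp (continuous_const.mul continuous_id)) h) c

theorem rmul_ι_apply (x : S.A₀) (c : C) : S.rmul x (S.ι c) = S.ι (c * x) := by
  have h : Set.EqOn (fun c => S.rmul x (S.ι c)) (fun c => S.ι (c * x)) (S.A₀ : Set C) :=
    fun c hc => S.rmul_ι x ⟨c, hc⟩
  exact congrFun (Continuous.ext_on S.dense_A₀ ((S.rmul x).continuous.comp S.continuous_ι)
    (S.continuous_ι.comp (continuous_id.mul continuous_const)) h) c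

theorem continuous_seminorm (l : Λ) : Continuous (S.p l) :=
  S.withSeminorms_p.continuous_seminorm l

theorem continuous_seminorm_ι (l : Λ) : Continuous fun c => S.p l (S.ι c) :=
  (S.continuous_seminorm l).comp S.continuous_ι

theorem exists_seminorm_ι_le (l : Λ) : ∃ R : ℝ, 0 < R ∧ ∀ c, S.p l (S.ι c) ≤ R * ‖c‖ := by
  obtain ⟨R, hR, h⟩ := Seminorm.bound_of_continuous_normedSpace ((S.p l).comp S.ι)
    (S.continuous_seminorm_ι l)
  exact ⟨R, hR, h⟩

theorem tendsto_iff {α : Type*} {F : Filter α} {u : α → X} {b : X} :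
    Tendsto u F (𝓝 b) ↔ ∀ l, ∀ ε > 0, ∀ᶠ i in F, S.p l (u i - b) < ε :=
  S.withSeminorms_p.tendsto_nhds u b

theorem tendsto_iff_seminorm {α : Type*} {F : Filter α} {u : α → X} {b : X} :
    Tendsto u F (𝓝 b) ↔ ∀ l, Tendsto (fun i => S.p l (u i - b)) F (𝓝 0) := by
  rw [S.tendsto_iff]
  refine forall_congr' fun l => ?_
  simp [Metric.tendsto_nhds, abs_of_nonneg]

/-- A net in `C` which is `τ`-convergent up to uniform norm errors is `τ`-convergent. -/
theorem tendsto_ι_of_forall_approx {α : Type*} {F : Filter α} {u : α → C} {u₀ : C}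
    (h : ∀ ε > 0, ∃ (v : α → C) (v₀ : C), (∀ᶠ i in F, ‖u i - v i‖ ≤ ε) ∧ ‖u₀ - v₀‖ ≤ ε ∧
      Tendsto (fun i => S.ι (v i)) F (𝓝 (S.ι v₀))) :
    Tendsto (fun i => S.ι (u i)) F (𝓝 (S.ι u₀)) := by
  rw [S.tendsto_iff]
  intro l ε hε
  obtain ⟨R, hR, hle⟩ := S.exists_seminorm_ι_le l
  obtain ⟨v, v₀, hv, hv₀, hlim⟩ := h (ε / (3 * R)) (by positivity)
  filter_upwards [hv, S.tendsto_iff.1 hlim l (ε / 3) (by positivity)] with i hi hi'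
  have h1 : S.p l (S.ι (u i - v i)) ≤ ε / 3 :=
    (hle _).trans ((mul_le_mul_of_nonneg_left hi hR.le).trans_eq (by field_simp))
  have h2 : S.p l (S.ι (u₀ - v₀)) ≤ ε / 3 :=
    (hle _).trans ((mul_le_mul_of_nonneg_left hv₀ hR.le).trans_eq (by field_simp))
  have e : S.ι (u i) - S.ι u₀ = S.ι (u i - v i) + (S.ι (v i) - S.ι v₀) - S.ι (u₀ - v₀) := by
    simp only [map_sub]; abel
  rw [e]
  have h3 := map_sub_le_add (S.p l) (S.ι (u i - v i) + (S.ι (v i) - S.ι v₀)) (S.ι (u₀ - v₀))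
  have h4 := map_add_le_add (S.p l) (S.ι (u i - v i)) (S.ι (v i) - S.ι v₀)
  linarith

/-- Multiplication by `c` in `C` need not be `τ`-continuous. On norm-bounded nets it is, since `c`
is a norm limit of elements of `A₀`, whose multiplications are continuous. -/
theorem tendsto_ι_mul_right {α : Type*} {F : Filter α} {u : α → C} {u₀ : C} {R : ℝ}
    (hR : ∀ᶠ i in F, ‖u i‖ ≤ R) (h : Tendsto (fun i => S.ι (u i)) F (𝓝 (S.ι u₀))) (c : C) :
    Tendsto (fun i => S.ι (u i * c)) F (𝓝 (S.ι (u₀ * c))) := by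
  refine S.tendsto_ι_of_forall_approx fun ε hε => ?_
  set R' := max 1 (max R ‖u₀‖)
  have hR' : 0 < R' := by positivity
  obtain ⟨x, hx, hxc⟩ := Metric.mem_closure_iff.1 (S.dense_A₀ c) (ε / R') (by positivity)
  rw [dist_eq_norm] at hxc
  have key : ∀ v : C, ‖v‖ ≤ R' → ‖v * c - v * x‖ ≤ ε := fun v hv => by
    rw [← mul_sub]
    refine (norm_mul_le _ _).trans ((mul_le_mul hv hxc.le (norm_nonneg _) hR'.le).trans_eq ?_)
    field_simp
  refine ⟨fun i => u i * x, u₀ * x, ?_, key u₀ (by simp [R']), ?_⟩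
  · filter_upwards [hR] with i hi using key _ (hi.trans (by simp [R']))
  · have := ((S.rmul ⟨x, hx⟩).continuous.tendsto _).comp h
    simpa only [Function.comp_def, S.rmul_ι_apply] using this

theorem tendsto_ι_mul_left {α : Type*} {F : Filter α} {u : α → C} {u₀ : C} {R : ℝ}
    (hR : ∀ᶠ i in F, ‖u i‖ ≤ R) (h : Tendsto (fun i => S.ι (u i)) F (𝓝 (S.ι u₀))) (c : C) :
    Tendsto (fun i => S.ι (c * u i)) F (𝓝 (S.ι (c * u₀))) := by
  have h' : Tendsto (fun i => S.ι (star (u i))) F (𝓝 (S.ι (star u₀))) := by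
    simpa only [S.ι_star] using h.star
  have := S.tendsto_ι_mul_right (R := R) (by simpa using hR) h' (star c)
  simpa only [← S.ι_star, star_mul, star_star] using this.star

/-- The norm closure in `C` of the `*`-algebra that a subset of `A₀` generates. -/
def closedAdjoin (T : Set S.A₀) : StarSubalgebra ℂ C :=
  ((StarAlgebra.adjoin ℂ T).map S.A₀.subtype).topologicalClosure

theorem isClosed_closedAdjoin (T : Set S.A₀) : IsClosed (S.closedAdjoin T : Set C) :=
  StarSubalgebra.isClosed_topologicalClosure _

theorem mem_closedAdjoin {T : Set S.A₀} {x : S.A₀} (hx : x ∈ T) : (x : C) ∈ S.closedAdjoin T :=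
  StarSubalgebra.le_topologicalClosure _ ⟨x, StarAlgebra.subset_adjoin ℂ T hx, rfl⟩

variable {S}

/-- Both sides are norm-continuous in `(u, v)`, so it suffices to treat the dense `*`-algebra
generated by `T`. It is commutative because the generators commute and are self-adjoint. -/
theorem seminorm_ι_mul_le {T : Set S.A₀}
    {l l' : Λ} {γ : ℝ} (h : ∀ x y : S.A₀, x * y = y * x →
      S.p l (S.ι (x * y)) ≤ γ * ‖x‖ * S.p l' (S.ι y))
    (hT : ∀ x ∈ T, ∀ x' ∈ T, x * x' = x' * x) (hsa : ∀ x ∈ T, IsSelfAdjoint x)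
    {u v : C} (hu : u ∈ S.closedAdjoin T) (hv : v ∈ S.closedAdjoin T) :
    S.p l (S.ι (u * v)) ≤ γ * ‖u‖ * S.p l' (S.ι v) := by
  have hcomm := StarAlgebra.isMulCommutative_adjoin ℂ hT
    (fun x hx x' hx' => by rw [(hsa x' hx').star_eq]; exact hT x hx x' hx')
  let D : Set C := ((StarAlgebra.adjoin ℂ T).map S.A₀.subtype : StarSubalgebra ℂ C)
  have hcl : IsClosed {q : C × C | S.p l (S.ι (q.1 * q.2)) ≤ γ * ‖q.1‖ * S.p l' (S.ι q.2)} :=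
    isClosed_le ((S.continuous_seminorm_ι l).comp continuous_mul)
      ((continuous_const.mul continuous_fst.norm).mul
        ((S.continuous_seminorm_ι l').comp continuous_snd))
  have hsub : D ×ˢ D ⊆
      {q : C × C | S.p l (S.ι (q.1 * q.2)) ≤ γ * ‖q.1‖ * S.p l' (S.ι q.2)} := by
    rintro ⟨_, _⟩ ⟨⟨x, hx, rfl⟩, ⟨x', hx', rfl⟩⟩
    exact h x x' (congrArg Subtype.val
      (mul_comm' (⟨x, hx⟩ : StarAlgebra.adjoin ℂ T) ⟨x', hx'⟩))
  have : (u, v) ∈ closure (D ×ˢ D) := by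
    rw [closure_prod_eq]; exact ⟨hu, hv⟩
  exact closure_minimal hsub hcl this

end Embedding

end TauCompletion

/-! ### Resolvents of positive elements. -/

section Resolvent

variable {c : C}

theorem isUnit_one_add (hc : 0 ≤ c) : IsUnit (1 + c) :=
  CStarAlgebra.isUnit_of_le (1 : C) (le_add_of_nonneg_right hc)

theorem inverse_one_add_nonneg (hc : 0 ≤ c) : 0 ≤ Ring.inverse (1 + c) := by
  obtain ⟨u, hu⟩ := isUnit_one_add hc
  have h : (0 : C) ≤ u := hu ▸ add_nonneg zero_le_one hc
  rw [← hu, Ring.inverse_unit]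
  have h' := star_left_conjugate_nonneg h (↑u⁻¹ : C)
  rw [mul_assoc, Units.mul_inv, mul_one] at h'
  simpa using star_nonneg_iff.2 h'

theorem norm_inverse_one_add_le (hc : 0 ≤ c) : ‖Ring.inverse (1 + c)‖ ≤ 1 := by
  obtain ⟨u, hu⟩ := isUnit_one_add hc
  have h : (1 : C) ≤ u := hu ▸ le_add_of_nonneg_right hc
  rw [CStarAlgebra.norm_le_one_iff_of_nonneg _ (inverse_one_add_nonneg hc), ← hu,
    Ring.inverse_unit]
  exact CStarAlgebra.inv_le_one h

theorem inverse_one_add_mem (hc : 0 ≤ c) {E : StarSubalgebra ℂ C} (hE : IsClosed (E : Set C))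
    (h : c ∈ E) : Ring.inverse (1 + c) ∈ E := by
  have : CompleteSpace E := hE.completeSpace_coe
  have hu : IsUnit (1 + ⟨c, h⟩ : E) := (StarSubalgebra.coe_isUnit E).1 (isUnit_one_add hc)
  have h1 : ((Ring.inverse (1 + ⟨c, h⟩ : E) : E) : C) * (1 + c) = 1 :=
    congrArg Subtype.val (Ring.inverse_mul_cancel _ hu)
  have h2 : Ring.inverse (1 + c) = (Ring.inverse (1 + ⟨c, h⟩ : E) : E) := by
    have h3 := congrArg (· * Ring.inverse (1 + c)) h1
    simpa only [mul_assoc, Ring.mul_inverse_cancel _ (isUnit_one_add hc), mul_one, one_mul]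
      using h3.symm
  exact h2 ▸ Subtype.property _

open scoped ComplexOrder

/-- The unit interval, as a subset of `ℂ`. -/
def unitInterval : Set ℂ := Complex.ofReal '' Set.Icc 0 1

instance : CompactSpace unitInterval :=
  isCompact_iff_compactSpace.1 (isCompact_Icc.image Complex.continuous_ofReal)

theorem spectrum_subset_unitInterval (hc : 0 ≤ c) (hc' : ‖c‖ ≤ 1) :
    spectrum ℂ c ⊆ unitInterval := by
  intro z hz
  have hre := (IsSelfAdjoint.of_nonneg hc).mem_spectrum_eq_re hz
  have hnn : 0 ≤ z := spectrum_nonneg_of_nonneg hc hz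
  have : Nontrivial C := by
    by_contra h
    rw [not_nontrivial_iff_subsingleton] at h
    simp [spectrum.of_subsingleton] at hz
  have hle : ‖z‖ ≤ 1 := (spectrum.norm_le_norm_of_mem hz).trans hc'
  rw [Complex.le_def] at hnn
  exact ⟨z.re, ⟨hnn.1, (Complex.re_le_norm z).trans hle⟩, hre.symm⟩

end Resolvent

/-! ### Existence of the inverse of `1 + a`. -/

namespace TauCompletion

open scoped ComplexOrder in
-- The spectrum can only shrink on passing from `A₀` to the larger algebra `C`.
theorem nonneg_of_mem_posA₀ {S : TauCompletion C X Λ} {x : S.A₀} (hx : x ∈ S.posA₀) :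
    0 ≤ (x : C) := by
  have hsa : IsSelfAdjoint (x : C) := congrArg Subtype.val hx.1
  rw [StarOrderedRing.nonneg_iff_spectrum_nonneg (R := ℂ) (x : C) (ha := hsa.isStarNormal)]
  intro z hz
  obtain ⟨r, hr, rfl⟩ := hx.2 z (AlgHom.spectrum_apply_subset S.A₀.subtype x hz)
  exact_mod_cast hr

section Inverse

variable {S : TauCompletion C X Λ}

theorem mem_nonneg_ball_of_tendsto (A : QuasiCStarNormedAlgebra S) {α : Type*} {F : Filter α}
    [F.NeBot] {u : α → C} (hu : ∀ᶠ i in F, 0 ≤ u i ∧ ‖u i‖ ≤ 1) {b : X}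
    (h : Tendsto (fun i => S.ι (u i)) F (𝓝 b)) : ∃ c, 0 ≤ c ∧ ‖c‖ ≤ 1 ∧ S.ι c = b := by
  obtain ⟨c, hc, rfl⟩ := A.closed_ball.mem_of_tendsto h (hu.mono fun i hi => ⟨u i, hi, rfl⟩)
  exact ⟨c, hc.1, hc.2, rfl⟩

/-- The seminorms of a product of elements of a commutative closed subalgebra that is generated
by positive elements of `A₀`. -/
theorem exists_seminorm_mul_le (A : QuasiCStarNormedAlgebra S) {T : Set S.A₀}
    (hT : T ⊆ S.posA₀) (hcomm : ∀ x ∈ T, ∀ x' ∈ T, x * x' = x' * x) (l : Λ) :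
    ∃ l' γ, 0 < γ ∧ ∀ u ∈ S.closedAdjoin T, ∀ v ∈ S.closedAdjoin T,
      S.p l (S.ι (u * v)) ≤ γ * ‖u‖ * S.p l' (S.ι v) := by
  obtain ⟨l', γ, hγ, h⟩ := A.mul_bound l
  exact ⟨l', γ, hγ, fun u hu v hv =>
    seminorm_ι_mul_le h hcomm (fun x hx => (hT hx).1) hu hv⟩

theorem inverse_one_add_mem_closedAdjoin {T : Set S.A₀} (hT : T ⊆ S.posA₀) {x : S.A₀}
    (hx : x ∈ T) : Ring.inverse (1 + (x : C)) ∈ S.closedAdjoin T :=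
  inverse_one_add_mem (nonneg_of_mem_posA₀ (hT hx)) (S.isClosed_closedAdjoin T)
    (S.mem_closedAdjoin hx)

theorem closedAdjoin_mul_comm {T : Set S.A₀} (hT : T ⊆ S.posA₀)
    (hcomm : ∀ x ∈ T, ∀ x' ∈ T, x * x' = x' * x) {u v : C} (hu : u ∈ S.closedAdjoin T)
    (hv : v ∈ S.closedAdjoin T) : u * v = v * u := by
  have hc := StarAlgebra.isMulCommutative_adjoin ℂ hcomm
    (fun x hx x' hx' => by rw [(hT hx').1.star_eq]; exact hcomm x hx x' hx')
  let D : Set C := ((StarAlgebra.adjoin ℂ T).map S.A₀.subtype : StarSubalgebra ℂ C)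
  have hcl : IsClosed {q : C × C | q.1 * q.2 = q.2 * q.1} :=
    isClosed_eq continuous_mul (continuous_snd.mul continuous_fst)
  have hsub : D ×ˢ D ⊆ {q : C × C | q.1 * q.2 = q.2 * q.1} := by
    rintro ⟨_, _⟩ ⟨⟨x, hx, rfl⟩, ⟨x', hx', rfl⟩⟩
    exact congrArg (fun z : StarAlgebra.adjoin ℂ T => ((z : S.A₀) : C))
      (mul_comm' (⟨x, hx⟩ : StarAlgebra.adjoin ℂ T) ⟨x', hx'⟩)
  have : (u, v) ∈ closure (D ×ˢ D) := by
    rw [closure_prod_eq]; exact ⟨hu, hv⟩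
  exact closure_minimal hsub hcl this

theorem exists_isInvOneAdd (A : QuasiCStarNormedAlgebra S) {a : X} (ha : a ∈ S.commQuasiPos) :
    ∃ y : C, S.IsInvOneAdd a y := by
  obtain ⟨T, hT, hcomm, haT⟩ := ha
  let f : S.A₀ → X := fun x => S.ι x
  let Y : S.A₀ → C := fun x => Ring.inverse (1 + (x : C))
  let F : Filter S.A₀ := comap f (𝓝 a) ⊓ 𝓟 T
  have hne : F.NeBot := by
    rw [← map_neBot_iff f, Filter.push_pull', map_principal]
    exact mem_closure_iff_clusterPt.1 haT
  have hTF : T ∈ F := mem_inf_of_right (mem_principal_self T)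
  have hlim : Tendsto f F (𝓝 a) := tendsto_comap.mono_left inf_le_left
  have hY : ∀ x ∈ T, 0 ≤ Y x ∧ ‖Y x‖ ≤ 1 := fun x hx =>
    ⟨inverse_one_add_nonneg (nonneg_of_mem_posA₀ (hT hx)),
      norm_inverse_one_add_le (nonneg_of_mem_posA₀ (hT hx))⟩
  have hYE : ∀ x ∈ T, Y x ∈ S.closedAdjoin T := fun x hx => inverse_one_add_mem_closedAdjoin hT hx
  have hYl : ∀ x ∈ T, Y x * (1 + (x : C)) = 1 := fun x hx =>
    Ring.inverse_mul_cancel _ (isUnit_one_add (nonneg_of_mem_posA₀ (hT hx)))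
  have hYr : ∀ x ∈ T, (1 + (x : C)) * Y x = 1 := fun x hx =>
    Ring.mul_inverse_cancel _ (isUnit_one_add (nonneg_of_mem_posA₀ (hT hx)))
  have hE1 : ∀ x ∈ T, (1 + (x : C)) ∈ S.closedAdjoin T := fun x hx =>
    add_mem (one_mem _) (S.mem_closedAdjoin hx)
  -- The resolvent identity. Its factor `Y x' * Y x` has norm at most `1`, so the resolvents inherit
  -- the Cauchy property from the net of the `x`.
  have hYd : ∀ x ∈ T, ∀ x' ∈ T, Y x' - Y x = Y x' * Y x * ((x : C) - x') := by
    intro x hx x' hx'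
    rw [mul_assoc, closedAdjoin_mul_comm hT hcomm (hYE x hx)
      (sub_mem (S.mem_closedAdjoin hx) (S.mem_closedAdjoin hx')),
      show (x : C) - x' = (1 + (x : C)) - (1 + x') by abel, sub_mul, mul_sub, hYr x hx,
      ← mul_assoc, hYl x' hx', mul_one, one_mul]
  have hcauchy : Cauchy (F.map fun x => S.ι (Y x)) := by
    rw [cauchy_map_iff', uniformity_eq_comap_nhds_zero, tendsto_comap_iff, S.tendsto_iff]
    intro l ε hε
    obtain ⟨l', γ, hγ, hle⟩ := exists_seminorm_mul_le A hT hcomm l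
    have h := inter_mem hTF (S.tendsto_iff.1 hlim l' (ε / (2 * γ)) (by positivity))
    filter_upwards [prod_mem_prod h h] with q ⟨⟨h1, h1'⟩, ⟨h2, h2'⟩⟩
    simp only [Set.mem_ofPred_eq] at h1' h2'
    have e := hYd _ h1 _ h2
    have hn : ‖Y q.2 * Y q.1‖ ≤ 1 := (norm_mul_le _ _).trans
      (mul_le_one₀ (hY _ h2).2 (norm_nonneg _) (hY _ h1).2)
    have hb := hle _ (mul_mem (hYE _ h2) (hYE _ h1)) _
      (sub_mem (S.mem_closedAdjoin h1) (S.mem_closedAdjoin h2))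
    have ht := map_sub_le_add (S.p l') (f q.1 - a) (f q.2 - a)
    rw [show f q.1 - a - (f q.2 - a) = S.ι ((q.1 : C) - q.2) by simp [f]] at ht
    simp only [Function.comp_apply, sub_zero, ← map_sub, e]
    calc _ ≤ _ := hb
      _ ≤ γ * 1 * (S.p l' (f q.1 - a) + S.p l' (f q.2 - a)) := by gcongr
      _ < γ * 1 * (ε / (2 * γ) + ε / (2 * γ)) := by gcongr
      _ = ε := by field_simp; norm_num
  obtain ⟨b, hb⟩ := CompleteSpace.complete hcauchy
  have hb' : Tendsto (fun x => S.ι (Y x)) F (𝓝 b) := hb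
  obtain ⟨y, hy0, hy1, rfl⟩ := mem_nonneg_ball_of_tendsto A
    (Filter.mem_of_superset hTF hY) hb'
  have hbd : ∀ᶠ x in F, ‖Y x‖ ≤ 1 := Filter.mem_of_superset hTF fun x hx => (hY x hx).2
  refine ⟨y, F, hne, ⟨T, hTF, hT, hcomm, fun x hx => ?_⟩, hlim, ?_, hb'⟩
  -- The commutation of `x` with the resolvents passes to their limit `y`.
  · refine S.ι_injective (tendsto_nhds_unique (S.tendsto_ι_mul_left hbd hb' x) ?_)
    refine (S.tendsto_ι_mul_right hbd hb' x).congr' ?_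
    filter_upwards [hTF] with x' hx'
    rw [closedAdjoin_mul_comm hT hcomm (hYE x' hx') (S.mem_closedAdjoin hx)]
  -- For fixed `x`, the identity `(1 + x) Y x' - 1 = Y x' (x - x')` bounds the left side by `γ * p
  -- l' (x - x')`. Letting `x'` run along the net replaces `Y x'` by `y` and `x'` by `a`.
  · rw [S.tendsto_iff]
    intro l ε hε
    obtain ⟨l', γ, hγ, hle⟩ := exists_seminorm_mul_le A hT hcomm l
    filter_upwards [hTF, S.tendsto_iff.1 hlim l' (ε / γ) (by positivity)] with x hx hxε
    have h1 : Tendsto (fun x' => S.p l (S.ι ((1 + (x : C)) * Y x') - S.ι 1)) F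
        (𝓝 (S.p l (S.ι ((1 + (x : C)) * y) - S.ι 1))) :=
      ((S.continuous_seminorm l).tendsto _).comp
        ((S.tendsto_ι_mul_left hbd hb' (1 + (x : C))).sub_const _)
    have h2 : Tendsto (fun x' => γ * S.p l' (f x - f x')) F (𝓝 (γ * S.p l' (f x - a))) :=
      (((S.continuous_seminorm l').tendsto _).comp (hlim.const_sub _)).const_mul γ
    refine (le_of_tendsto_of_tendsto h1 h2 ?_).trans_lt ?_
    · filter_upwards [hTF] with x' hx'
      have e : (1 + (x : C)) * Y x' - 1 = Y x' * ((x : C) - x') := by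
        rw [closedAdjoin_mul_comm hT hcomm (hE1 x hx) (hYE x' hx'),
          show (x : C) - x' = (1 + (x : C)) - (1 + x') by abel, mul_sub, hYl x' hx']
      rw [← map_sub, e]
      refine (hle _ (hYE _ hx') _
        (sub_mem (S.mem_closedAdjoin hx) (S.mem_closedAdjoin hx'))).trans ?_
      have : γ * ‖Y x'‖ ≤ γ * 1 := by gcongr; exact (hY x' hx').2
      rw [map_sub]
      refine (mul_le_mul_of_nonneg_right this (apply_nonneg _ _)).trans_eq (by rw [mul_one])
    · have : γ * S.p l' (f x - a) < γ * (ε / γ) := by gcongr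
      rwa [mul_div_cancel₀ _ hγ.ne'] at this

end Inverse

end TauCompletion

/-! ### Approximations of `0` and of `1 / t` on the unit interval. -/

section Damping

variable (K : Set ℂ)

/-- The identity function of a set of complex numbers. -/
noncomputable def idFun : C(K, ℂ) := .restrict K (.id ℂ)

@[simp] theorem idFun_apply (t : K) : idFun K t = (t : ℂ) := rfl

/-- The function `t ↦ 1 / (1 + (m + 1) |t|)`. -/
noncomputable def damping (m : ℕ) : C(K, ℂ) where
  toFun t := (((1 + ((m : ℝ) + 1) * ‖(t : ℂ)‖)⁻¹ : ℝ) : ℂ)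
  continuous_toFun := by
    refine Complex.continuous_ofReal.comp (Continuous.inv₀ (by fun_prop) fun t => ?_)
    positivity

/-- The function `t ↦ (m + 1) / (1 + (m + 1) |t|)`, an approximation of `1 / t` for `t > 0`. -/
noncomputable def approxInv (m : ℕ) : C(K, ℂ) := ((m : ℂ) + 1) • damping K m

theorem damping_apply (m : ℕ) (t : K) :
    damping K m t = (((1 + ((m : ℝ) + 1) * ‖(t : ℂ)‖)⁻¹ : ℝ) : ℂ) := rfl

variable {K}

theorem norm_eq_of_mem_unitInterval {z : ℂ} (hz : z ∈ unitInterval) : (‖z‖ : ℂ) = z := by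
  obtain ⟨r, hr, rfl⟩ := hz
  simp [abs_of_nonneg hr.1]

theorem approxInv_mul_idFun (hK : K ⊆ unitInterval) (m : ℕ) :
    approxInv K m * idFun K = 1 - damping K m := by
  ext t
  have h := norm_eq_of_mem_unitInterval (hK t.2)
  have hne : (1 + ((m : ℂ) + 1) * ‖(t : ℂ)‖) ≠ 0 := by
    have : 0 < 1 + ((m : ℝ) + 1) * ‖(t : ℂ)‖ := by positivity
    exact_mod_cast this.ne'
  simp only [approxInv, ContinuousMap.mul_apply, ContinuousMap.smul_apply, damping_apply,
    idFun_apply, ContinuousMap.sub_apply, ContinuousMap.one_apply, smul_eq_mul]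
  push_cast
  nth_rewrite 2 [← h]
  field_simp
  ring

variable [CompactSpace K]

theorem norm_damping_le (m : ℕ) : ‖damping K m‖ ≤ 1 := by
  refine (ContinuousMap.norm_le _ zero_le_one).2 fun t => ?_
  rw [damping_apply, Complex.norm_real, Real.norm_of_nonneg (by positivity)]
  exact inv_le_one_of_one_le₀ (le_add_of_nonneg_right (by positivity))

theorem norm_damping_mul_idFun_le (m : ℕ) : ‖damping K m * idFun K‖ ≤ 1 / ((m : ℝ) + 1) := by
  refine (ContinuousMap.norm_le _ (by positivity)).2 fun t => ?_
  rw [ContinuousMap.mul_apply, norm_mul, damping_apply, Complex.norm_real,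
    Real.norm_of_nonneg (by positivity), idFun_apply, inv_mul_eq_div,
    div_le_div_iff₀ (by positivity) (by positivity)]
  linarith [norm_nonneg (t : ℂ)]

end Damping

/-! ### From functions of the resolvents to functions of their limit. -/

section Net

variable {S : TauCompletion C X Λ} {α : Type*} {G : Filter α} {E : StarSubalgebra ℂ C}
  {π : α → C(unitInterval, ℂ) →⋆ₐ[ℂ] C} {π₀ : C(unitInterval, ℂ) →⋆ₐ[ℂ] C}

/-- A net of functional calculi on `[0, 1]` with values in a subalgebra `E`, for which the images
of the identity function are `τ`-convergent. The product of `E` is subject to a continuity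
condition. -/
structure IsCalculusNet (S : TauCompletion C X Λ) (G : Filter α) (E : StarSubalgebra ℂ C)
    (π : α → C(unitInterval, ℂ) →⋆ₐ[ℂ] C) (π₀ : C(unitInterval, ℂ) →⋆ₐ[ℂ] C) : Prop where
  mem : ∀ i f, π i f ∈ E
  bound : ∀ l, ∃ l' γ, 0 < γ ∧ ∀ u ∈ E, ∀ v ∈ E,
    S.p l (S.ι (u * v)) ≤ γ * ‖u‖ * S.p l' (S.ι v)
  tendsto_idFun : Tendsto (fun i => S.ι (π i (idFun unitInterval))) G
    (𝓝 (S.ι (π₀ (idFun unitInterval))))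

namespace IsCalculusNet

theorem norm_le (π₀ : C(unitInterval, ℂ) →⋆ₐ[ℂ] C) (f : C(unitInterval, ℂ)) : ‖π₀ f‖ ≤ ‖f‖ :=
  NonUnitalStarAlgHom.norm_apply_le π₀ f

/-- The values of `π₀` need not lie in `E`, so `bound` does not apply to them. The inequality is
used along the net instead and survives in the limit; `b'` stands for the product of `π₀ f` with
`b`. -/
theorem limit_le [G.NeBot] (h : IsCalculusNet S G E π π₀) (l : Λ) :
    ∃ l' γ, 0 < γ ∧ ∀ (f : C(unitInterval, ℂ)) (φ : α → C) (b b' : X),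
      (∀ᶠ i in G, φ i ∈ E) → Tendsto (fun i => S.ι (φ i)) G (𝓝 b) →
      Tendsto (fun i => S.ι (π i f * φ i)) G (𝓝 b') → S.p l b' ≤ γ * ‖f‖ * S.p l' b := by
  obtain ⟨l', γ, hγ, hle⟩ := h.bound l
  refine ⟨l', γ, hγ, fun f φ b b' hφ hb hb' => ?_⟩
  refine le_of_tendsto_of_tendsto (((S.continuous_seminorm l).tendsto _).comp hb')
    ((((S.continuous_seminorm l').tendsto _).comp hb).const_mul (γ * ‖f‖)) ?_
  filter_upwards [hφ] with i hi
  refine (hle _ (h.mem i f) _ hi).trans ?_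
  have := norm_le (π i) f
  simp only [Function.comp_apply]
  gcongr

theorem tendsto_mul [G.NeBot] (h : IsCalculusNet S G E π π₀) {f g : C(unitInterval, ℂ)}
    (hf : Tendsto (fun i => S.ι (π i f)) G (𝓝 (S.ι (π₀ f))))
    (hg : Tendsto (fun i => S.ι (π i g)) G (𝓝 (S.ι (π₀ g)))) :
    Tendsto (fun i => S.ι (π i (f * g))) G (𝓝 (S.ι (π₀ (f * g)))) := by
  rw [S.tendsto_iff_seminorm]
  intro l
  obtain ⟨l', γ, hγ, hle⟩ := h.bound l
  -- As `π₀ g` may lie outside `E`, it is replaced by `π j g`, and the limit is taken over `j`.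
  have h1 : ∀ i, S.p l (S.ι (π i f * (π i g - π₀ g))) ≤
      γ * ‖f‖ * S.p l' (S.ι (π i g) - S.ι (π₀ g)) := fun i => by
    have hd : Tendsto (fun j => S.ι (π i g - π j g)) G (𝓝 (S.ι (π i g - π₀ g))) := by
      simpa only [map_sub] using hg.const_sub (S.ι (π i g))
    have hbd : ∀ᶠ j in G, ‖π i g - π j g‖ ≤ ‖g‖ + ‖g‖ := .of_forall fun j =>
      (norm_sub_le _ _).trans (add_le_add (norm_le _ _) (norm_le _ _))
    rw [← map_sub]
    refine le_of_tendsto_of_tendsto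
      (((S.continuous_seminorm l).tendsto _).comp (S.tendsto_ι_mul_left hbd hd (π i f)))
      ((((S.continuous_seminorm l').tendsto _).comp hd).const_mul (γ * ‖f‖)) ?_
    refine .of_forall fun j => ?_
    refine (hle _ (h.mem i f) _ (sub_mem (h.mem i g) (h.mem j g))).trans ?_
    have := norm_le (π i) f
    simp only [Function.comp_apply]
    gcongr
  have h2 : Tendsto (fun i => S.p l (S.ι (π i f * π₀ g) - S.ι (π₀ f * π₀ g))) G (𝓝 0) :=
    S.tendsto_iff_seminorm.1 (S.tendsto_ι_mul_right (.of_forall fun i => norm_le (π i) f) hf _) l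
  have h3 := (S.tendsto_iff_seminorm.1 hg l').const_mul (γ * ‖f‖)
  refine squeeze_zero (fun i => apply_nonneg _ _) (fun i => ?_)
    (by simpa using h3.add h2)
  have e : S.ι (π i (f * g)) - S.ι (π₀ (f * g)) =
      S.ι (π i f * (π i g - π₀ g)) + (S.ι (π i f * π₀ g) - S.ι (π₀ f * π₀ g)) := by
    simp only [map_mul, mul_sub, map_sub]; abel
  rw [e]
  exact (map_add_le_add _ _ _).trans (add_le_add_left (h1 i) _)

/-- By Stone–Weierstrass: convergence at `t` gives it for polynomials, and all the calculi are
norm-contractive, so it survives uniform limits. -/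
theorem tendsto [G.NeBot] (h : IsCalculusNet S G E π π₀) (f : C(unitInterval, ℂ)) :
    Tendsto (fun i => S.ι (π i f)) G (𝓝 (S.ι (π₀ f))) := by
  induction f using ContinuousMap.induction_on_of_compact with
  | const r =>
    have e : ∀ ρ : C(unitInterval, ℂ) →⋆ₐ[ℂ] C, ρ (.const _ r) = algebraMap ℂ C r :=
      fun ρ => AlgHomClass.commutes ρ r
    simp only [e]
    exact tendsto_const_nhds
  | id => exact h.tendsto_idFun
  | star_id =>
    have : star (.restrict unitInterval (.id ℂ)) = idFun unitInterval := by
      ext ⟨_, r, hr, rfl⟩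
      exact Complex.conj_ofReal r
    rw [this]
    exact h.tendsto_idFun
  | add f g hf hg => simpa only [map_add] using hf.add hg
  | mul f g hf hg => exact h.tendsto_mul hf hg
  | frequently f hf =>
    refine S.tendsto_ι_of_forall_approx fun ε hε => ?_
    obtain ⟨g, hg, hgε⟩ := (hf.and_eventually (Metric.ball_mem_nhds f hε)).exists
    rw [dist_comm, dist_eq_norm] at hgε
    have key : ∀ ρ : C(unitInterval, ℂ) →⋆ₐ[ℂ] C, ‖ρ f - ρ g‖ ≤ ε := fun ρ => by
      rw [← map_sub]; exact (norm_le ρ _).trans hgε.le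
    exact ⟨fun i => π i g, π₀ g, .of_forall fun i => key _, key _, hg⟩

theorem seminorm_mul_le [G.NeBot] (h : IsCalculusNet S G E π π₀) (l : Λ) :
    ∃ l' γ, 0 < γ ∧ ∀ f g : C(unitInterval, ℂ),
      S.p l (S.ι (π₀ (f * g))) ≤ γ * ‖f‖ * S.p l' (S.ι (π₀ g)) := by
  obtain ⟨l', γ, hγ, hle⟩ := h.limit_le l
  refine ⟨l', γ, hγ, fun f g => hle f (fun i => π i g) _ _ (.of_forall fun i => h.mem i g)
    (h.tendsto g) ?_⟩
  simpa only [map_mul] using h.tendsto (f * g)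

/-- Here `x i` is the element of which `π i` is the functional calculus of `(1 + x i)⁻¹`. -/
theorem tendsto_damping_mul [G.NeBot] (h : IsCalculusNet S G E π π₀) {x : α → S.A₀}
    (hx : ∀ i, (x i : C) ∈ E)
    (hlim : Tendsto (fun i => S.ι ((1 + (x i : C)) * π₀ (idFun unitInterval))) G (𝓝 (S.ι 1)))
    (hcomm : ∀ u ∈ E, ∀ v ∈ E, u * v = v * u) (v : S.A₀) (hv : (v : C) ∈ E) :
    Tendsto (fun m => S.ι (π₀ (damping unitInterval m) * v)) atTop (𝓝 0) := by
  set t := idFun unitInterval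
  rw [S.tendsto_iff]
  intro l ε hε
  obtain ⟨l', γ, hγ, hle⟩ := h.limit_le l
  obtain ⟨R, hR, hRle⟩ := S.exists_seminorm_ι_le l
  have hv1 : Tendsto (fun i => S.ι (v * (1 - (1 + (x i : C)) * π₀ t))) G (𝓝 0) := by
    have h1 := ((S.lmul v).continuous.tendsto _).comp (hlim.const_sub (S.ι 1))
    simpa only [Function.comp_def, ← map_sub, S.lmul_ι_apply, sub_self, mul_zero, map_zero] using h1
  obtain ⟨i₁, hi₁⟩ := (S.tendsto_iff.1 hv1 l' (ε / (2 * γ)) (by positivity)).exists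
  have hsmall : Tendsto (fun m : ℕ => R * (1 / ((m : ℝ) + 1) * ‖(v : C) * (1 + (x i₁ : C))‖)) atTop
      (𝓝 0) := by
    simpa using (tendsto_one_div_add_atTop_nhds_zero_nat.mul_const _).const_mul R
  filter_upwards [hsmall.eventually_lt_const (half_pos hε)] with m hm
  have hE1 : (v : C) * (1 + (x i₁ : C)) ∈ E := mul_mem hv (add_mem (one_mem _) (hx i₁))
  -- With `d = damping m` and `y = π₀ t`, write `d(y) v = d(y) v (1 - (1 + x) y) + (d t)(y) v (1 +
  -- x)`. The first term is small for a suitable `x = x i₁`, uniformly in `m`; the second has norm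
  -- at most a constant over `m + 1`.
  have h1 : S.p l (S.ι (π₀ (damping _ m) * v) -
      S.ι (π₀ (damping _ m * t) * (v * (1 + (x i₁ : C))))) ≤
      γ * ‖damping unitInterval m‖ * S.p l' (S.ι (v * (1 - (1 + (x i₁ : C)) * π₀ t))) := by
    refine hle _ (fun i => v * (1 - (1 + (x i₁ : C)) * π i t)) _ _ (.of_forall fun i =>
      mul_mem hv (sub_mem (one_mem _) (mul_mem (add_mem (one_mem _) (hx i₁)) (h.mem i t)))) ?_ ?_
    · have := (S.tendsto_ι_mul_left (.of_forall fun i => norm_le (π i) t) (h.tendsto t)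
        ((v : C) * (1 + (x i₁ : C)))).const_sub (S.ι v)
      simpa only [← map_sub, mul_sub, mul_one, mul_assoc] using this
    · have h2 := S.tendsto_ι_mul_right (.of_forall fun i => norm_le (π i) (damping _ m))
        (h.tendsto (damping _ m)) (v : C)
      have h3 := S.tendsto_ι_mul_right (.of_forall fun i => norm_le (π i) (damping _ m * t))
        (h.tendsto (damping _ m * t)) ((v : C) * (1 + (x i₁ : C)))
      refine (h2.sub h3).congr fun i => ?_
      rw [← map_sub, map_mul (π i), mul_assoc, hcomm _ (h.mem i t) _ hE1]
      simp only [mul_sub, mul_one, mul_assoc]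
  have h4 : S.p l (S.ι (π₀ (damping _ m * t) * (v * (1 + (x i₁ : C))))) < ε / 2 := by
    refine ((hRle _).trans (mul_le_mul_of_nonneg_left ((norm_mul_le _ _).trans ?_) hR.le)).trans_lt
      hm
    exact mul_le_mul_of_nonneg_right
      ((norm_le π₀ _).trans (norm_damping_mul_idFun_le m)) (norm_nonneg _)
  have h5 : γ * ‖damping unitInterval m‖ * S.p l' (S.ι (v * (1 - (1 + (x i₁ : C)) * π₀ t)))
      < ε / 2 := by
    rw [sub_zero] at hi₁
    calc _ ≤ γ * 1 * S.p l' (S.ι (v * (1 - (1 + (x i₁ : C)) * π₀ t))) := by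
          gcongr; exact norm_damping_le m
      _ < γ * 1 * (ε / (2 * γ)) := by gcongr
      _ = ε / 2 := by field_simp
  have h6 := map_add_le_add (S.p l) (S.ι (π₀ (damping _ m) * v) -
      S.ι (π₀ (damping _ m * t) * (v * (1 + (x i₁ : C)))))
      (S.ι (π₀ (damping _ m * t) * (v * (1 + (x i₁ : C)))))
  rw [sub_add_cancel] at h6
  rw [sub_zero]
  linarith

theorem tendsto_approx [G.NeBot] (h : IsCalculusNet S G E π π₀) {x : α → S.A₀}
    (hx : ∀ i, (x i : C) ∈ E)
    (hlim : Tendsto (fun i => S.ι ((1 + (x i : C)) * π₀ (idFun unitInterval))) G (𝓝 (S.ι 1)))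
    (hcomm : ∀ u ∈ E, ∀ v ∈ E, u * v = v * u)
    (hinv : ∀ i, π i (idFun unitInterval) * (1 + (x i : C)) = 1) {a : X}
    (ha : Tendsto (fun i => S.ι (x i)) G (𝓝 a)) :
    Tendsto (fun m => S.ι (π₀ ((1 - idFun unitInterval) * approxInv unitInterval m))) atTop
      (𝓝 a) := by
  set t := idFun unitInterval
  rw [S.tendsto_iff]
  intro l ε hε
  obtain ⟨l', γ, hγ, hle⟩ := h.limit_le l
  obtain ⟨i₀, hi₀⟩ := (S.tendsto_iff.1 ha l' (ε / (2 * γ)) (by positivity)).exists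
  have hd := h.tendsto_damping_mul hx hlim hcomm (x i₀) (hx i₀)
  filter_upwards [S.tendsto_iff.1 hd l (ε / 2) (by positivity)] with m hm
  rw [sub_zero] at hm
  -- Since `t x = 1 - t` at each resolvent, the error of the approximation of `x i` is `d x i`. In
  -- the limit the error for `a` is compared with `d x i₀`, which tends to `0` in `m`; the
  -- difference `d (x i - x i₀)` is controlled by `a - x i₀`, uniformly in `m`.
  have e : ∀ i, π i (damping _ m) * (x i : C) =
      x i - π i ((1 - t) * approxInv unitInterval m) := fun i => by
    have h1 : π i t * (x i : C) = 1 - π i t := by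
      have := hinv i
      rw [mul_add, mul_one] at this
      rw [← this]; abel
    have h2 : damping unitInterval m = 1 - approxInv unitInterval m * t := by
      rw [approxInv_mul_idFun subset_rfl]; abel
    rw [h2, mul_comm (1 - t), map_sub, map_one, map_mul, sub_mul, one_mul, mul_assoc, h1, map_mul,
      map_sub, map_one]
  have h1 : S.p l (a - S.ι (π₀ ((1 - t) * approxInv unitInterval m)) -
      S.ι (π₀ (damping _ m) * x i₀)) ≤
      γ * ‖damping unitInterval m‖ * S.p l' (a - S.ι (x i₀)) := by
    refine hle _ (fun i => (x i : C) - x i₀) _ _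
      (.of_forall fun i => sub_mem (hx i) (hx i₀)) ?_ ?_
    · simpa only [map_sub] using ha.sub_const (S.ι (x i₀))
    · have h2 := S.tendsto_ι_mul_right (.of_forall fun i => norm_le (π i) (damping _ m))
        (h.tendsto (damping _ m)) (x i₀ : C)
      refine ((ha.sub (h.tendsto ((1 - t) * approxInv unitInterval m))).sub h2).congr fun i => ?_
      rw [mul_sub, e]
      simp only [map_sub]
  have h2 : γ * ‖damping unitInterval m‖ * S.p l' (a - S.ι (x i₀)) < ε / 2 := by
    rw [map_sub_rev] at hi₀
    calc _ ≤ γ * 1 * S.p l' (a - S.ι (x i₀)) := by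
          gcongr; exact norm_damping_le m
      _ < γ * 1 * (ε / (2 * γ)) := by gcongr
      _ = ε / 2 := by field_simp
  have h6 := map_add_le_add (S.p l) (a - S.ι (π₀ ((1 - t) * approxInv unitInterval m)) -
      S.ι (π₀ (damping _ m) * x i₀)) (S.ι (π₀ (damping _ m) * x i₀))
  rw [sub_add_cancel, map_sub_rev] at h6
  linarith

end IsCalculusNet

end Net

/-! ### The calculus of `y` on its spectrum. -/

section Calculus

variable {S : TauCompletion C X Λ}

/-- The restriction of a continuous function to a smaller set. -/
noncomputable def restrictFun {K L : Set ℂ} (h : K ⊆ L) (f : C(L, ℂ)) : C(K, ℂ) :=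
  f.comp ⟨Set.inclusion h, continuous_inclusion h⟩

/-- Tietze extension without increase of norm. The resolvents have different spectra, so their
calculi share only the domain `C([0, 1])`; this carries the seminorm inequality from there to `C(K)`
with the norm of `C(K)`. -/
theorem exists_restrictFun_eq {K L : Set ℂ} [CompactSpace K] [CompactSpace L] (h : K ⊆ L)
    (f : C(K, ℂ)) : ∃ g : C(L, ℂ), ‖g‖ = ‖f‖ ∧ restrictFun h g = f := by
  have hK : IsClosed K := (isCompact_iff_compactSpace.2 ‹_›).isClosed
  obtain ⟨g, hg, hgf⟩ := (BoundedContinuousFunction.mkOfCompact f).exists_norm_eq_domRestrict_eq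
    (𝕜 := ℂ) hK
  have hr : restrictFun h (g.toContinuousMap.restrict L) = f := by
    ext t
    exact DFunLike.congr_fun hgf t
  refine ⟨g.toContinuousMap.restrict L, le_antisymm ?_ ?_, hr⟩
  · refine (ContinuousMap.norm_le _ (norm_nonneg _)).2 fun t => ?_
    exact (g.norm_coe_le_norm _).trans_eq hg
  · refine (ContinuousMap.norm_le _ (norm_nonneg _)).2 fun t => ?_
    rw [← hr]
    exact (g.toContinuousMap.restrict L).norm_coe_le_norm (Set.inclusion h t)

theorem TauCompletion.IsInvOneAdd.nonneg_norm_le (A : QuasiCStarNormedAlgebra S) {a : X} {y : C}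
    (h : S.IsInvOneAdd a y) : 0 ≤ y ∧ ‖y‖ ≤ 1 := by
  obtain ⟨F, hF, ⟨T, hTF, hT, -, -⟩, -, -, hy⟩ := h
  obtain ⟨c, hc, hc', he⟩ := TauCompletion.mem_nonneg_ball_of_tendsto A
    (Filter.mem_of_superset hTF fun x hx =>
      ⟨inverse_one_add_nonneg (TauCompletion.nonneg_of_mem_posA₀ (hT hx)),
        norm_inverse_one_add_le (TauCompletion.nonneg_of_mem_posA₀ (hT hx))⟩) hy
  exact S.ι_injective he ▸ ⟨hc, hc'⟩

/-- The continuous functional calculus of an element with spectrum in `[0, 1]`. -/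
noncomputable def unitCalculus (y : C) (h : 0 ≤ y ∧ ‖y‖ ≤ 1) : C(unitInterval, ℂ) →⋆ₐ[ℂ] C :=
  cfcHomSuperset (IsSelfAdjoint.of_nonneg h.1).isStarNormal (spectrum_subset_unitInterval h.1 h.2)

theorem unitCalculus_idFun (y : C) (h : 0 ≤ y ∧ ‖y‖ ≤ 1) :
    unitCalculus y h (idFun unitInterval) = y :=
  cfcHomSuperset_id _ _

theorem unitCalculus_mem {y : C} (h : 0 ≤ y ∧ ‖y‖ ≤ 1) {E : StarSubalgebra ℂ C}
    (hE : IsClosed (E : Set C)) (hy : y ∈ E) (f : C(unitInterval, ℂ)) :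
    unitCalculus y h f ∈ E :=
  StarAlgebra.elemental.le_of_mem hE hy (cfcHom_mem_elemental _ _)

/-- The net of the functional calculi of the elements `(1 + x)⁻¹`, together with the properties
of the net of the elements `x`. -/
theorem exists_isCalculusNet (A : QuasiCStarNormedAlgebra S) {a : X} {y : C}
    (h : S.IsInvOneAdd a y) (hy : 0 ≤ y ∧ ‖y‖ ≤ 1) :
    ∃ (T : Set S.A₀) (G : Filter T) (E : StarSubalgebra ℂ C)
      (π : T → C(unitInterval, ℂ) →⋆ₐ[ℂ] C), G.NeBot ∧
      IsCalculusNet S G E π (unitCalculus y hy) ∧ (∀ x : T, ((x : S.A₀) : C) ∈ E) ∧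
      Tendsto (fun x : T => S.ι ((1 + (x : S.A₀)) * unitCalculus y hy (idFun unitInterval))) G
        (𝓝 (S.ι 1)) ∧ (∀ u ∈ E, ∀ v ∈ E, u * v = v * u) ∧
      (∀ x : T, π x (idFun unitInterval) * (1 + ((x : S.A₀) : C)) = 1) ∧
      Tendsto (fun x : T => S.ι (x : S.A₀)) G (𝓝 a) := by
  obtain ⟨F, hF, ⟨T, hTF, hT, hcomm, -⟩, ha, h1, hlim⟩ := h
  have hpos : ∀ x : T, 0 ≤ ((x : S.A₀) : C) := fun x =>
    TauCompletion.nonneg_of_mem_posA₀ (hT x.2)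
  have hinv : ∀ x : T, 0 ≤ Ring.inverse (1 + ((x : S.A₀) : C)) ∧
      ‖Ring.inverse (1 + ((x : S.A₀) : C))‖ ≤ 1 := fun x =>
    ⟨inverse_one_add_nonneg (hpos x), norm_inverse_one_add_le (hpos x)⟩
  have hval : Tendsto (Subtype.val : T → S.A₀) (comap Subtype.val F) F := tendsto_comap
  refine ⟨T, comap Subtype.val F, S.closedAdjoin T, fun x => unitCalculus _ (hinv x), ?_, ?_,
    fun x => S.mem_closedAdjoin x.2, ?_, fun u hu v hv =>
      TauCompletion.closedAdjoin_mul_comm hT hcomm hu hv, fun x => ?_, ha.comp hval⟩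
  · exact hF.comap_of_range_mem (by simpa using hTF)
  · refine ⟨fun x f => unitCalculus_mem _ (S.isClosed_closedAdjoin T)
      (TauCompletion.inverse_one_add_mem_closedAdjoin hT x.2) f,
      TauCompletion.exists_seminorm_mul_le A hT hcomm, ?_⟩
    simpa only [unitCalculus_idFun, Function.comp_def] using hlim.comp hval
  · simpa only [unitCalculus_idFun, Function.comp_def] using h1.comp hval
  · rw [unitCalculus_idFun]
    exact Ring.inverse_mul_cancel _ (isUnit_one_add (hpos x))

/-- The continuous functional calculus of an inverse of `1 + a`: the topology `τ` is compatible
with the product, and `a` is approximated by functions of `(1 + a)⁻¹`. -/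
theorem TauCompletion.IsInvOneAdd.calculus (A : QuasiCStarNormedAlgebra S) {a : X} {y : C}
    (h : S.IsInvOneAdd a y) (hy : IsStarNormal y) :
    spectrum ℂ y ⊆ unitInterval ∧
    (∀ l, ∃ l' γ, 0 < γ ∧ ∀ f g : C(spectrum ℂ y, ℂ),
      S.p l (S.ι (cfcHom hy (f * g))) ≤ γ * ‖f‖ * S.p l' (S.ι (cfcHom hy g))) ∧
    Tendsto (fun m => S.ι (cfcHom hy (damping (spectrum ℂ y) m))) atTop (𝓝 0) ∧
    Tendsto (fun m => S.ι (cfcHom hy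
      ((1 - idFun (spectrum ℂ y)) * approxInv (spectrum ℂ y) m))) atTop (𝓝 a) := by
  have hy' := h.nonneg_norm_le A
  obtain ⟨T, G, E, π, hG, hN, hxE, hlim, hcomm, hinv, ha⟩ := exists_isCalculusNet A h hy'
  have hsub := spectrum_subset_unitInterval hy'.1 hy'.2
  refine ⟨hsub, fun l => ?_, ?_, ?_⟩
  · obtain ⟨l', γ, hγ, hle⟩ := hN.seminorm_mul_le l
    refine ⟨l', γ, hγ, fun f g => ?_⟩
    obtain ⟨f, hf, rfl⟩ := exists_restrictFun_eq hsub f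
    obtain ⟨g, hg, rfl⟩ := exists_restrictFun_eq hsub g
    rw [← hf]
    exact hle f g
  · have := hN.tendsto_damping_mul hxE hlim hcomm 1 (one_mem _)
    simp only [OneMemClass.coe_one, mul_one] at this
    exact this
  · exact hN.tendsto_approx hxE hlim hcomm hinv ha

end Calculus

/-! ### Modules over `C(K)` on which `t` acts injectively. -/

section CalculusModule

variable {K : Set ℂ} [CompactSpace K] {Y Λ : Type*} [AddCommGroup Y] [Module ℂ Y] [UniformSpace Y]
  [IsUniformAddGroup Y] [ContinuousSMul ℂ Y] [T2Space Y] {q : SeminormFamily ℂ Y Λ}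
  {j : C(K, ℂ) →ₗ[ℂ] Y} {act : C(K, ℂ) →ₐ[ℂ] (Y →L[ℂ] Y)}

/-- A locally convex space in which `C(K)`, for `K ⊆ [0, 1]`, is dense, and to which the
multiplication of `C(K)` extends, in such a way that multiplication by `1 / t` is densely
defined. -/
structure IsCalculusModule (q : SeminormFamily ℂ Y Λ) (j : C(K, ℂ) →ₗ[ℂ] Y)
    (act : C(K, ℂ) →ₐ[ℂ] (Y →L[ℂ] Y)) : Prop where
  subset : K ⊆ unitInterval
  withSeminorms : WithSeminorms q
  injective : Function.Injective j
  dense : DenseRange j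
  act_apply : ∀ f g, act f (j g) = j (f * g)
  bound : ∀ l, ∃ l' γ, 0 < γ ∧ ∀ f b, q l (act f b) ≤ γ * ‖f‖ * q l' b
  tendsto_damping : Tendsto (fun m => j (damping K m)) atTop (𝓝 0)

/-- By `hb`, multiplication by `f` is continuous for the topology that the dense range of `j`
inherits from `Y`, hence extends by completeness. -/
theorem exists_mul_extension [CompleteSpace Y] (hq : WithSeminorms q)
    (hj : Function.Injective j) (hd : DenseRange j)
    (hb : ∀ l, ∃ l' γ, 0 < γ ∧ ∀ f g, q l (j (f * g)) ≤ γ * ‖f‖ * q l' (j g)) (f : C(K, ℂ)) :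
    ∃ M : Y →L[ℂ] Y, ∀ g, M (j g) = j (f * g) := by
  let V := LinearMap.range j
  have : IsUniformAddGroup V := V.toAddSubgroup.isUniformAddGroup
  let e : C(K, ℂ) ≃ₗ[ℂ] V := LinearEquiv.ofInjective j hj
  let g₀ : V →ₗ[ℂ] Y := j ∘ₗ LinearMap.mulLeft ℂ f ∘ₗ e.symm.toLinearMap
  have he : ∀ g, g₀ (e g) = j (f * g) := fun g => by simp [g₀]
  have hcont : Continuous g₀ := by
    refine continuous_of_continuousAt_zero g₀ ?_
    rw [ContinuousAt, map_zero, hq.tendsto_nhds]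
    intro l ε hε
    obtain ⟨l', γ, hγ, hle⟩ := hb l
    have h1 : Tendsto (fun v : V => γ * ‖f‖ * q l' (v : Y)) (𝓝 0) (𝓝 0) := by
      have : Continuous fun v : V => γ * ‖f‖ * q l' (v : Y) :=
        continuous_const.mul ((hq.continuous_seminorm l').comp continuous_subtype_val)
      simpa using this.tendsto 0
    filter_upwards [h1.eventually_lt_const hε] with v hv
    obtain ⟨g, rfl⟩ := e.surjective v
    rw [sub_zero, he]
    exact (hle f g).trans_lt hv
  have hdV : DenseRange V.subtypeL := by
    rwa [DenseRange, Submodule.coe_subtypeL, Submodule.coe_subtype, Subtype.range_coe]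
  have hiV : IsUniformInducing V.subtypeL := isUniformEmbedding_subtype_val.isUniformInducing
  refine ⟨ContinuousLinearMap.extend ⟨g₀, hcont⟩ V.subtypeL, fun g => ?_⟩
  exact (ContinuousLinearMap.extend_eq ⟨g₀, hcont⟩ hdV hiV (e g)).trans (he g)

theorem exists_isCalculusModule [CompleteSpace Y] (hK : K ⊆ unitInterval) (hq : WithSeminorms q)
    (hj : Function.Injective j) (hd : DenseRange j)
    (hb : ∀ l, ∃ l' γ, 0 < γ ∧ ∀ f g, q l (j (f * g)) ≤ γ * ‖f‖ * q l' (j g))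
    (ht : Tendsto (fun m => j (damping K m)) atTop (𝓝 0)) :
    ∃ act : C(K, ℂ) →ₐ[ℂ] (Y →L[ℂ] Y), IsCalculusModule q j act := by
  choose M hM using exists_mul_extension hq hj hd hb
  have hext : ∀ {M₁ M₂ : Y →L[ℂ] Y}, (∀ g, M₁ (j g) = M₂ (j g)) → M₁ = M₂ := fun h =>
    DFunLike.coe_injective (hd.equalizer (ContinuousLinearMap.continuous _)
      (ContinuousLinearMap.continuous _) (funext h))
  refine ⟨{ toFun := M
            map_one' := hext fun g => by simp [hM]
            map_mul' := fun f f' => hext fun g => by simp [hM, mul_assoc]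
            map_zero' := hext fun g => by simp [hM]
            map_add' := fun f f' => hext fun g => by simp [hM, add_mul]
            commutes' := fun r => hext fun g => by
              simp [hM, Algebra.algebraMap_eq_smul_one] },
    ⟨hK, hq, hj, hd, hM, fun l => ?_, ht⟩⟩
  obtain ⟨l', γ, hγ, hle⟩ := hb l
  refine ⟨l', γ, hγ, fun f b => ?_⟩
  refine hd.induction_on (p := fun b => q l (M f b) ≤ γ * ‖f‖ * q l' b) b ?_ fun g => ?_
  · exact isClosed_le ((hq.continuous_seminorm l).comp (M f).continuous)
      (continuous_const.mul (hq.continuous_seminorm l'))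
  · rw [hM]; exact hle f g

namespace IsCalculusModule

theorem act_comm (f g : C(K, ℂ)) (b : Y) : act f (act g b) = act g (act f b) := by
  rw [← mul_apply_eq_comp, ← map_mul, mul_comm, map_mul,
    mul_apply_eq_comp]

theorem act_mul (f g : C(K, ℂ)) (b : Y) : act (f * g) b = act f (act g b) := by
  rw [map_mul, mul_apply_eq_comp]

theorem act_one (b : Y) : act 1 b = b := by
  rw [map_one, one_apply_eq_self]

theorem tendsto_iff_seminorm (h : IsCalculusModule q j act) {α : Type*} {F : Filter α}
    {u : α → Y} {b : Y} :
    Tendsto u F (𝓝 b) ↔ ∀ l, Tendsto (fun i => q l (u i - b)) F (𝓝 0) := by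
  rw [h.withSeminorms.tendsto_nhds]
  refine forall_congr' fun l => ?_
  simp [Metric.tendsto_nhds, abs_of_nonneg]

/-- Applying `act g` to the convergence at `1` gives it at `j g`. The operators `act (damping K m)`
are equicontinuous, so density gives it everywhere. -/
theorem tendsto_act_damping (h : IsCalculusModule q j act) (b : Y) :
    Tendsto (fun m => act (damping K m) b) atTop (𝓝 0) := by
  rw [h.withSeminorms.tendsto_nhds]
  intro l ε hε
  obtain ⟨l', γ, hγ, hle⟩ := h.bound l
  have hopen : IsOpen {b' | q l' (b - b') < ε / (2 * γ)} := isOpen_lt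
    ((h.withSeminorms.continuous_seminorm l').comp (continuous_const.sub continuous_id))
    continuous_const
  obtain ⟨g, hg⟩ := h.dense.exists_mem_open hopen ⟨b, by simp; positivity⟩
  have h1 : Tendsto (fun m => act g (j (damping K m))) atTop (𝓝 0) := by
    simpa [Function.comp_def] using ((act g).continuous.tendsto 0).comp h.tendsto_damping
  filter_upwards [h.withSeminorms.tendsto_nhds _ _ |>.1 h1 l (ε / 2) (by positivity)] with m hm
  rw [sub_zero, h.act_apply, mul_comm, ← h.act_apply] at hm
  have h2 : q l (act (damping K m) (b - j g)) < ε / 2 := by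
    calc _ ≤ γ * ‖damping K m‖ * q l' (b - j g) := hle _ _
      _ ≤ γ * 1 * q l' (b - j g) := by gcongr; exact norm_damping_le m
      _ < γ * 1 * (ε / (2 * γ)) := by gcongr; exact hg
      _ = ε / 2 := by field_simp
  have h3 := map_add_le_add (q l) (act (damping K m) (b - j g)) (act (damping K m) (j g))
  rw [← map_add, sub_add_cancel] at h3
  rw [sub_zero]
  linarith

/-- From `1 = damping + approxInv · t`, an element killed by `t` equals its own damped versions,
which tend to `0`. -/
theorem eq_zero_of_act_idFun (h : IsCalculusModule q j act) {b : Y} (hb : act (idFun K) b = 0) :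
    b = 0 := by
  refine tendsto_nhds_unique ((tendsto_const_nhds (x := b)).congr fun m => ?_)
    (h.tendsto_act_damping b)
  have e : damping K m = 1 - approxInv K m * idFun K := by
    rw [approxInv_mul_idFun h.subset]; abel
  rw [e, map_sub, _root_.sub_apply, act_one, act_mul, hb, map_zero, sub_zero]

theorem act_idFun_pow_injective (h : IsCalculusModule q j act) (k : ℕ) :
    Function.Injective (act (idFun K ^ k)) := by
  induction k with
  | zero => intro b b' hb; simpa using hb
  | succ k ih =>
    refine (injective_iff_map_eq_zero _).2 fun b hb => ?_
    rw [pow_succ', act_mul] at hb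
    exact (injective_iff_map_eq_zero _).1 ih b (h.eq_zero_of_act_idFun hb)

/-- A bounded net of functions whose multiplications converge strongly to the identity. -/
def IsApproxUnit (act : C(K, ℂ) →ₐ[ℂ] (Y →L[ℂ] Y)) {α : Type*} (F : Filter α)
    (u : α → C(K, ℂ)) : Prop :=
  (∃ R, ∀ i, ‖u i‖ ≤ R) ∧ ∀ b, Tendsto (fun i => act (u i) b) F (𝓝 b)

theorem isApproxUnit_damping (h : IsCalculusModule q j act) :
    IsApproxUnit act atTop fun m => 1 - damping K m := by
  refine ⟨⟨‖(1 : C(K, ℂ))‖ + 1, fun m => (norm_sub_le _ _).trans ?_⟩, fun b => ?_⟩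
  · gcongr; exact norm_damping_le m
  · simpa [map_sub] using (h.tendsto_act_damping b).const_sub b

theorem IsApproxUnit.comp {α β : Type*} {F : Filter α} {G : Filter β} {u : α → C(K, ℂ)}
    (hu : IsApproxUnit act F u) {φ : β → α} (hφ : Tendsto φ G F) :
    IsApproxUnit act G (u ∘ φ) :=
  ⟨hu.1.imp fun _ hR _ => hR _, fun b => (hu.2 b).comp hφ⟩

theorem IsApproxUnit.mul (h : IsCalculusModule q j act) {α : Type*} {F : Filter α}
    {u v : α → C(K, ℂ)} (hu : IsApproxUnit act F u) (hv : IsApproxUnit act F v) :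
    IsApproxUnit act F (u * v) := by
  obtain ⟨R, hR⟩ := hu.1
  obtain ⟨R', hR'⟩ := hv.1
  refine ⟨⟨|R| * |R'|, fun i => (norm_mul_le _ _).trans ?_⟩, fun b => ?_⟩
  · gcongr
    exacts [(hR i).trans (le_abs_self R), (hR' i).trans (le_abs_self R')]
  · have h1 : Tendsto (fun i => act (u i) (act (v i) b - b)) F (𝓝 0) := by
      rw [h.tendsto_iff_seminorm]
      intro l
      obtain ⟨l', γ, hγ, hle⟩ := h.bound l
      have h2 := (h.tendsto_iff_seminorm.1 (hv.2 b) l').const_mul (γ * |R|)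
      rw [mul_zero] at h2
      refine squeeze_zero (fun i => apply_nonneg _ _) (fun i => ?_) h2
      rw [sub_zero]
      refine (hle _ _).trans ?_
      gcongr
      exact (hR i).trans (le_abs_self R)
    simpa [act_mul, map_sub] using h1.add (hu.2 b)

theorem IsApproxUnit.pow (h : IsCalculusModule q j act) {α : Type*} {F : Filter α}
    {u : α → C(K, ℂ)} (hu : IsApproxUnit act F u) (k : ℕ) : IsApproxUnit act F (u ^ k) := by
  induction k with
  | zero =>
    refine ⟨⟨‖(1 : C(K, ℂ))‖, fun i => by simp⟩, fun b => ?_⟩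
    simpa [act_one] using tendsto_const_nhds
  | succ k ih => rw [pow_succ]; exact ih.mul h hu

/-- If `b = t ^ (-k)`, then the `k`-th powers of the approximations of `1 / t` converge to `b`. -/
theorem tendsto_approxInv_pow (h : IsCalculusModule q j act) {k : ℕ} {b : Y}
    (hb : act (idFun K ^ k) b = j 1) :
    Tendsto (fun m => j (approxInv K m ^ k)) atTop (𝓝 b) := by
  refine ((h.isApproxUnit_damping.pow h k).2 b).congr fun m => ?_
  rw [Pi.pow_apply, ← approxInv_mul_idFun h.subset, mul_pow, act_mul, hb, h.act_apply, mul_one]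

/-- The product in `LeftMul` is a joint limit over two independent indices, so the approximate units
in the two indices are multiplied. -/
theorem tendsto_approxInv_pow_mul (h : IsCalculusModule q j act) {k l : ℕ} {b : Y}
    (hb : act (idFun K ^ (k + l)) b = j 1) :
    Tendsto (fun m : ℕ × ℕ => j (approxInv K m.1 ^ k * approxInv K m.2 ^ l)) (atTop ×ˢ atTop)
      (𝓝 b) := by
  have h1 := (h.isApproxUnit_damping.pow h k).comp (tendsto_fst (f := atTop) (g := atTop (α := ℕ)))
  have h2 := (h.isApproxUnit_damping.pow h l).comp (tendsto_snd (f := atTop (α := ℕ)) (g := atTop))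
  refine ((h1.mul h h2).2 b).congr fun m => ?_
  simp only [Pi.mul_apply, Function.comp_apply, Pi.pow_apply]
  rw [← approxInv_mul_idFun h.subset, ← approxInv_mul_idFun h.subset, mul_pow, mul_pow,
    mul_mul_mul_comm, ← pow_add, act_mul, hb, h.act_apply, mul_one]

theorem tendsto_of_tendsto_prod {α β : Type*} {F : Filter α} {G : Filter β} [G.NeBot]
    {f : α × β → Y} {g : α → Y} {d : Y} (hd : Tendsto f (F ×ˢ G) (𝓝 d))
    (hg : ∀ i, Tendsto (fun i' => f (i, i')) G (𝓝 (g i))) : Tendsto g F (𝓝 d) := by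
  refine (closed_nhds_basis d).tendsto_right_iff.2 fun V hV => ?_
  filter_upwards [(hd.eventually hV.1).curry] with i hi
  exact hV.2.mem_of_tendsto (hg i) hi

/-- The value of a product, up to a multiplication that takes the second factor into `C(K)`. -/
theorem act_eq_of_tendsto_mul (h : IsCalculusModule q j act) {F G : Filter C(K, ℂ)} [F.NeBot]
    [G.NeBot] {b c d : Y} (hb : Tendsto j F (𝓝 b)) (hc : Tendsto j G (𝓝 c))
    (hd : Tendsto (fun p : C(K, ℂ) × C(K, ℂ) => j (p.1 * p.2)) (F ×ˢ G) (𝓝 d))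
    {r s : C(K, ℂ)} (hr : act r c = j s) : act r d = act s b := by
  -- The joint limit is an iterated one: `r d = lim_f lim_g r f g = lim_f f s = s b`.
  refine tendsto_nhds_unique (tendsto_of_tendsto_prod (F := F)
    (((act r).continuous.tendsto d).comp hd) fun f => ?_) (((act s).continuous.tendsto b).comp hb)
  have h1 := (((act f).comp (act r)).continuous.tendsto c).comp hc
  have e : act s (j f) = (act f).comp (act r) c := by
    rw [ContinuousLinearMap.comp_apply, hr, h.act_apply, h.act_apply, mul_comm]
  rw [Function.comp_apply, e]
  refine h1.congr fun g => ?_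
  simp only [Function.comp_apply, ContinuousLinearMap.comp_apply, h.act_apply]
  rw [mul_left_comm]

end IsCalculusModule

end CalculusModule

/-! ### The `τ`-closure of `C*(a)`, and its products. -/

section Model

instance (Y : Submodule ℂ X) : IsUniformAddGroup Y := Y.toAddSubgroup.isUniformAddGroup

variable {S : TauCompletion C X Λ} {a : X} {y : C} {hy : IsStarNormal y} {Y : Submodule ℂ X}
  {j : C(spectrum ℂ y, ℂ) →ₗ[ℂ] Y} {act : C(spectrum ℂ y, ℂ) →ₐ[ℂ] (Y →L[ℂ] Y)}

/-- The `τ`-closure `Y` of the `C*`-algebra of `y = (1 + a)⁻¹`, as a module over the continuous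
functions on the spectrum of `y`. -/
structure IsCalculusModel (S : TauCompletion C X Λ) (a : X) (hy : IsStarNormal y)
    (j : C(spectrum ℂ y, ℂ) →ₗ[ℂ] Y) (act : C(spectrum ℂ y, ℂ) →ₐ[ℂ] (Y →L[ℂ] Y)) : Prop
    extends IsCalculusModule (S.p.comp Y.subtype) j act where
  isClosed : IsClosed (Y : Set X)
  coe_apply : ∀ f, (j f : X) = S.ι (cfcHom hy f)
  exists_act_eq : ∃ b : Y, (b : X) = a ∧ act (idFun _) b = j (1 - idFun _)

theorem exists_isCalculusModel (A : QuasiCStarNormedAlgebra S) (h : S.IsInvOneAdd a y)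
    (hy : IsStarNormal y) : ∃ (Y : Submodule ℂ X) (j : C(spectrum ℂ y, ℂ) →ₗ[ℂ] Y)
      (act : C(spectrum ℂ y, ℂ) →ₐ[ℂ] (Y →L[ℂ] Y)), IsCalculusModel S a hy j act := by
  obtain ⟨hK, hb, hdamp, ha⟩ := h.calculus A hy
  let J : C(spectrum ℂ y, ℂ) →ₗ[ℂ] X := S.ι ∘ₗ (cfcHom hy).toAlgHom.toLinearMap
  have hJ : ∀ f, J f = S.ι (cfcHom hy f) := fun f => rfl
  let Y : Submodule ℂ X := (LinearMap.range J).topologicalClosure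
  have hclosed : IsClosed (Y : Set X) := Submodule.isClosed_topologicalClosure _
  have hmem : ∀ f, J f ∈ Y := fun f => Submodule.le_topologicalClosure _ ⟨f, rfl⟩
  let j : C(spectrum ℂ y, ℂ) →ₗ[ℂ] Y := J.codRestrict Y hmem
  have hj : ∀ f, (j f : X) = S.ι (cfcHom hy f) := fun f => rfl
  have hcomplete : CompleteSpace Y := hclosed.completeSpace_coe
  have hq : WithSeminorms (S.p.comp Y.subtype) := LinearMap.withSeminorms_induced
    S.withSeminorms_p Y.subtype
  have hinj : Function.Injective j := fun f g hfg =>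
    cfcHom_injective hy (S.ι_injective (congrArg Subtype.val hfg))
  have hdense : DenseRange j := by
    intro b
    rw [closure_subtype, ← Set.range_comp]
    exact b.2
  obtain ⟨act, hact⟩ := exists_isCalculusModule hK hq hinj hdense hb
    (tendsto_subtype_rng.2 hdamp)
  have haY : a ∈ Y := hclosed.mem_of_tendsto ha (.of_forall fun m => hmem _)
  refine ⟨Y, j, act, hact, hclosed, hj, ⟨a, haY⟩, rfl, ?_⟩
  -- Multiplying the approximations of `a` by `t` gives `(1 - t)(1 - damping m)`, which tends to `1
  -- - t`.
  have ha' : Tendsto (fun m => j ((1 - idFun (spectrum ℂ y)) * approxInv (spectrum ℂ y) m)) atTop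
      (𝓝 ⟨a, haY⟩) := tendsto_subtype_rng.2 ha
  have h1 := ((act (idFun _)).continuous.tendsto _).comp ha'
  have h2 := ((act (1 - idFun _)).continuous.tendsto _).comp hact.tendsto_damping
  have h3 := h2.const_sub (j (1 - idFun _))
  rw [map_zero, sub_zero] at h3
  refine tendsto_nhds_unique h1 (h3.congr fun m => ?_)
  simp only [Function.comp_apply, hact.act_apply, ← map_sub]
  rw [mul_left_comm, mul_comm (idFun _), approxInv_mul_idFun hK, mul_sub, mul_one]

theorem mem_elemental_iff (hy : IsStarNormal y) {z : C} :
    z ∈ StarAlgebra.elemental ℂ y ↔ ∃ f : C(spectrum ℂ y, ℂ), cfcHom hy f = z := by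
  rw [← range_cfcHom ℂ hy]; exact Iff.rfl

namespace IsCalculusModel

theorem exists_lift (h : IsCalculusModel S a hy j act) {F : Filter C} [F.NeBot]
    (hF : (StarAlgebra.elemental ℂ y : Set C) ∈ F) {b : X} (hb : Tendsto S.ι F (𝓝 b)) :
    ∃ F' : Filter C(spectrum ℂ y, ℂ), F'.NeBot ∧ map (cfcHom hy) F' = F ∧
      ∃ b' : Y, (b' : X) = b ∧ Tendsto j F' (𝓝 b') := by
  have hr : Set.range (cfcHom hy : C(spectrum ℂ y, ℂ) → C) ∈ F :=
    Filter.mem_of_superset hF fun z hz => (mem_elemental_iff hy).1 hz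
  have hm := map_comap_of_mem hr
  have hne : (comap (cfcHom hy : C(spectrum ℂ y, ℂ) → C) F).NeBot := by
    rw [← map_neBot_iff (cfcHom hy), hm]; infer_instance
  have hj : Tendsto (fun f => (j f : X)) (comap (cfcHom hy) F) (𝓝 b) := by
    simp only [h.coe_apply]
    exact hb.comp tendsto_comap
  have hbY : b ∈ Y := h.isClosed.mem_of_tendsto hj (.of_forall fun f => (j f).2)
  exact ⟨_, hne, hm, ⟨b, hbY⟩, rfl, tendsto_subtype_rng.2 hj⟩

theorem exists_net (h : IsCalculusModel S a hy j act) (b : Y) :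
    ∃ F : Filter C(spectrum ℂ y, ℂ), F.NeBot ∧ Tendsto j F (𝓝 b) :=
  ⟨comap j (𝓝 b), comap_neBot_iff_frequently.2 (mem_closure_iff_frequently.1 (h.dense b)), tendsto_comap⟩

theorem tendsto_ι_map (h : IsCalculusModel S a hy j act) {α : Type*} {F : Filter α}
    {u : α → C(spectrum ℂ y, ℂ)} {b : Y} (hb : Tendsto (fun i => j (u i)) F (𝓝 b)) :
    Tendsto S.ι (F.map fun i => cfcHom hy (u i)) (𝓝 (b : X)) := by
  have := (continuous_subtype_val.tendsto b).comp hb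
  simpa only [tendsto_map'_iff, Function.comp_def, h.coe_apply] using this

/-- The product `b · z` is the module action; in particular it does not depend on the net. -/
theorem mulBy_iff (h : IsCalculusModel S a hy j act) {b w : X} {z : C} :
    S.MulBy (StarAlgebra.elemental ℂ y) b z w ↔
      ∃ (b' : Y) (f : C(spectrum ℂ y, ℂ)), (b' : X) = b ∧ cfcHom hy f = z ∧
        (act f b' : X) = w := by
  constructor
  · rintro ⟨hz, F, hF, hBF, hb, hw⟩
    obtain ⟨f, rfl⟩ := (mem_elemental_iff hy).1 hz
    obtain ⟨F', hF', rfl, b', hb', hlim⟩ := h.exists_lift hBF hb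
    refine ⟨b', f, hb', rfl, ?_⟩
    have h1 := (continuous_subtype_val.tendsto _).comp (((act f).continuous.tendsto b').comp hlim)
    refine tendsto_nhds_unique h1 ((tendsto_map'_iff.1 hw).congr fun g => ?_)
    simp only [Function.comp_apply, h.act_apply, h.coe_apply]
    rw [mul_comm f, map_mul (cfcHom hy)]
  · rintro ⟨b', f, rfl, rfl, rfl⟩
    obtain ⟨F, hF, hb⟩ := h.exists_net b'
    refine ⟨(mem_elemental_iff hy).2 ⟨f, rfl⟩, F.map (cfcHom hy), inferInstance,
      mem_map.2 (Eventually.of_forall fun g => (mem_elemental_iff hy).2 ⟨g, rfl⟩), h.tendsto_ι_map hb, ?_⟩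
    have h1 := h.tendsto_ι_map (u := fun g => f * g)
      ((((act f).continuous.tendsto b').comp hb).congr fun g => h.act_apply f g)
    rw [tendsto_map'_iff] at h1 ⊢
    refine h1.congr fun g => ?_
    simp only [Function.comp_apply]
    rw [mul_comm f, map_mul (cfcHom hy)]

theorem strongMul (h : IsCalculusModel S a hy j act) (f : C(spectrum ℂ y, ℂ)) (b : Y) :
    S.StrongMul (b : X) (cfcHom hy f) (act f b : X) := by
  obtain ⟨F, hF, hb⟩ := h.exists_net b
  refine ⟨F.map (cfcHom hy), inferInstance, ?_, h.tendsto_ι_map hb, ?_⟩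
  · exact eventually_map.2 (.of_forall fun g => by rw [← map_mul, ← map_mul, mul_comm])
  · have h1 := h.tendsto_ι_map (u := fun g => f * g)
      ((((act f).continuous.tendsto b).comp hb).congr fun g => h.act_apply f g)
    rw [tendsto_map'_iff] at h1 ⊢
    refine h1.congr fun g => ?_
    simp only [Function.comp_apply]
    rw [mul_comm f, map_mul (cfcHom hy)]

/-- The closing implication says `d = b c` without division: if `c = s / r`, then `r d = s b`. With
`r` a power of `t`, which acts injectively, it determines `d`, whatever nets define the product. -/
theorem leftMul (h : IsCalculusModel S a hy j act) {A : Submodule ℂ X} {b c d : X}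
    (hm : S.LeftMul A (StarAlgebra.elemental ℂ y) b c d) :
    ∃ b' c' d' : Y, (b' : X) = b ∧ (c' : X) = c ∧ (d' : X) = d ∧
      ∀ r s, act r c' = j s → act r d' = act s b' := by
  obtain ⟨-, -, -, F, G, hF, hG, hBF, hBG, hb, hc, hd⟩ := hm
  obtain ⟨F', hF', rfl, b', hb', hFb⟩ :=
    h.exists_lift (Filter.mem_of_superset hBF fun z hz => hz.1) hb
  obtain ⟨G', hG', rfl, c', hc', hGc⟩ :=
    h.exists_lift (Filter.mem_of_superset hBG fun z hz => hz.1) hc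
  rw [prod_map_map_eq, tendsto_map'_iff] at hd
  have hd' : Tendsto (fun p : C(spectrum ℂ y, ℂ) × C(spectrum ℂ y, ℂ) => (j (p.1 * p.2) : X))
      (F' ×ˢ G') (𝓝 d) := by
    refine hd.congr fun p => ?_
    simp only [Function.comp_apply, h.coe_apply, map_mul]
  have hdY : d ∈ Y := h.isClosed.mem_of_tendsto hd' (.of_forall fun p => (j _).2)
  exact ⟨b', c', ⟨d, hdY⟩, hb', hc', rfl, fun r s hrs =>
      h.act_eq_of_tendsto_mul hFb hGc (tendsto_subtype_rng.2 hd') hrs⟩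

theorem prodValue (h : IsCalculusModel S a hy j act) {A : Submodule ℂ X} {u v w : X}
    (hm : S.ProdValue A (StarAlgebra.elemental ℂ y) u v w) :
    ∃ u' v' w' : Y, (u' : X) = u ∧ (v' : X) = v ∧ (w' : X) = w ∧
      ∀ r s, act r v' = j s → act r w' = act s u' := by
  obtain ⟨b, c, d, x, z, hbcd, hu, hv, hw⟩ := hm
  obtain ⟨b', c', d', rfl, rfl, rfl, hrs⟩ := h.leftMul hbcd
  obtain ⟨b₁, f, hb₁, rfl, rfl⟩ := h.mulBy_iff.1 hu
  obtain ⟨c₁, g, hc₁, rfl, rfl⟩ := h.mulBy_iff.1 hv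
  obtain ⟨d₁, k, hd₁, hk, rfl⟩ := h.mulBy_iff.1 hw
  obtain rfl := Subtype.coe_injective hb₁
  obtain rfl := Subtype.coe_injective hc₁
  obtain rfl := Subtype.coe_injective hd₁
  rw [← map_mul] at hk
  obtain rfl := cfcHom_injective hy hk
  refine ⟨_, _, _, rfl, rfl, rfl, fun r s hr => ?_⟩
  have h1 := hrs (r * g) s (by rw [IsCalculusModule.act_mul, hr])
  rw [IsCalculusModule.act_comm s f, ← h1, ← IsCalculusModule.act_mul,
    ← IsCalculusModule.act_mul]
  congr 2
  ring

open scoped ComplexOrder in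
theorem cfcHom_approxInv_pow_nonneg (hy : IsStarNormal y) (m k : ℕ) :
    0 ≤ cfcHom hy (approxInv (spectrum ℂ y) m ^ k) := by
  rw [cfcHom_nonneg_iff]
  intro t
  change 0 ≤ (approxInv (spectrum ℂ y) m t) ^ k
  refine pow_nonneg ?_ k
  simp only [approxInv, ContinuousMap.smul_apply, damping_apply, smul_eq_mul]
  have : (0 : ℝ) ≤ ((m : ℝ) + 1) * (1 + ((m : ℝ) + 1) * ‖(t : ℂ)‖)⁻¹ := by positivity
  exact_mod_cast this

/-- The negative powers of `t`, as far as they exist, are left multipliers of each other. -/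
theorem leftMul_of_act_idFun_pow (h : IsCalculusModel S a hy j act) {A : Submodule ℂ X} {k l : ℕ}
    {b c d : Y} (hb : act (idFun _ ^ k) b = j 1) (hc : act (idFun _ ^ l) c = j 1)
    (hd : act (idFun _ ^ (k + l)) d = j 1) (hbA : (b : X) ∈ A) (hcA : (c : X) ∈ A)
    (hdA : (d : X) ∈ A) : S.LeftMul A (StarAlgebra.elemental ℂ y) (b : X) c d := by
  refine ⟨hbA, hcA, hdA, atTop.map fun m => cfcHom hy (approxInv _ m ^ k),
    atTop.map fun m => cfcHom hy (approxInv _ m ^ l), inferInstance, inferInstance,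
    mem_map.2 (Eventually.of_forall fun m => ⟨cfcHom_mem_elemental _ _, cfcHom_approxInv_pow_nonneg hy m k⟩),
    mem_map.2 (Eventually.of_forall fun m => ⟨cfcHom_mem_elemental _ _, cfcHom_approxInv_pow_nonneg hy m l⟩),
    h.tendsto_ι_map (h.tendsto_approxInv_pow hb), h.tendsto_ι_map (h.tendsto_approxInv_pow hc), ?_⟩
  rw [prod_map_map_eq, tendsto_map'_iff]
  have h1 := h.tendsto_ι_map (h.tendsto_approxInv_pow_mul hd)
  rw [tendsto_map'_iff] at h1
  refine h1.congr fun p => ?_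
  simp only [Function.comp_apply, map_mul]

theorem exists_act_idFun_pow (h : IsCalculusModel S a hy j act) (A : QuasiCStarNormedAlgebra S)
    {n : ℕ} {w : X} (hw : S.IsPow A.carrier (StarAlgebra.elemental ℂ y) a n w) :
    (∃ b : Y, (b : X) = w ∧ act (idFun _ ^ n) b = j ((1 - idFun _) ^ n)) ∧
    ∀ k ≤ n, ∃ b : Y, (b : X) ∈ A.carrier ∧ act (idFun _ ^ k) b = j ((1 - idFun _) ^ k) := by
  induction n generalizing w with
  | zero =>
    have h0 : ((j 1 : Y) : X) = S.ι 1 := by rw [h.coe_apply, map_one]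
    refine ⟨⟨j 1, h0.trans hw.symm, by simp⟩, fun k hk => ⟨j 1, ?_, ?_⟩⟩
    · rw [h0]; exact A.ι_mem 1
    · obtain rfl : k = 0 := by omega
      simp
  | succ n ih =>
    obtain ⟨v, hv, hm⟩ := hw
    obtain ⟨⟨v', hv', hvn⟩, hlow⟩ := ih hv
    obtain ⟨b', c', d', hb', hc', hd', hrs⟩ := h.leftMul hm
    obtain ⟨a', ha', hact⟩ := h.exists_act_eq
    obtain rfl : b' = a' := Subtype.coe_injective (hb'.trans ha'.symm)
    obtain rfl : c' = v' := Subtype.coe_injective (hc'.trans hv'.symm)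
    -- Here `t ^ n a ^ n = (1 - t) ^ n` gives `t ^ n a ^ (n + 1) = (1 - t) ^ n a`, and one more
    -- factor `t` turns `a` into `1 - t`.
    have key : act (idFun _ ^ (n + 1)) d' = j ((1 - idFun _) ^ (n + 1)) := by
      rw [pow_succ', IsCalculusModule.act_mul, hrs _ _ hvn, IsCalculusModule.act_comm, hact,
        h.act_apply, pow_succ]
    refine ⟨⟨d', hd', key⟩, fun k hk => ?_⟩
    rcases hk.lt_or_eq with hk | rfl
    · exact hlow k (by omega)
    · exact ⟨d', hd' ▸ hm.2.2.1, key⟩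

/-- If `a ^ n` exists, then the powers `(1 + a) ^ k` exist for `k ≤ n`. -/
theorem exists_act_idFun_pow_eq_one (h : IsCalculusModel S a hy j act)
    (A : QuasiCStarNormedAlgebra S) {n : ℕ}
    (hn : ∃ w, S.IsPow A.carrier (StarAlgebra.elemental ℂ y) a n w) :
    ∃ c : ℕ → Y, ∀ k ≤ n, (c k : X) ∈ A.carrier ∧ act (idFun _ ^ k) (c k) = j 1 := by
  obtain ⟨w, hw⟩ := hn
  choose! b hbA hb using (h.exists_act_idFun_pow A hw).2
  -- The binomial expansion of `(1 + a) ^ k`, with `b i` for `a ^ i`. Multiplied by `t ^ k` it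
  -- becomes the expansion of `((1 - t) + t) ^ k = 1`.
  refine ⟨fun k => ∑ i ∈ Finset.range (k + 1), k.choose i • b i, fun k hk => ⟨?_, ?_⟩⟩
  · rw [Submodule.coe_sum]
    refine sum_mem fun i hi => ?_
    rw [Submodule.coe_smul_of_tower]
    exact nsmul_mem (hbA i (by rw [Finset.mem_range] at hi; omega)) _
  · have e : (1 : C(spectrum ℂ y, ℂ)) = ((1 - idFun _) + idFun _) ^ k := by
      rw [sub_add_cancel, one_pow]
    rw [e, add_pow, map_sum, map_sum]
    refine Finset.sum_congr rfl fun i hi => ?_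
    rw [Finset.mem_range] at hi
    rw [map_nsmul, show k = (k - i) + i by omega, pow_add, IsCalculusModule.act_mul,
      hb i (by omega), h.act_apply, ← map_nsmul]
    congr 1
    rw [Nat.sub_add_cancel (by omega), nsmul_eq_mul]
    ring

end IsCalculusModel

end Model

/-! ### The coordinate change `t ↦ 1 / t - 1`. -/

section Spectrum

/-- The map `z ↦ 1 / z - 1` from `ℂ` to the Riemann sphere. -/
noncomputable def invSubOne (z : ℂ) : OnePoint ℂ :=
  open Classical in if z = 0 then OnePoint.infty else ((z⁻¹ - 1 : ℂ) : OnePoint ℂ)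

theorem invSubOne_zero : invSubOne 0 = OnePoint.infty := if_pos rfl

theorem invSubOne_of_ne_zero {z : ℂ} (hz : z ≠ 0) :
    invSubOne z = ((z⁻¹ - 1 : ℂ) : OnePoint ℂ) := if_neg hz

theorem invSubOne_eq_coe_iff {z l : ℂ} : invSubOne z = (l : OnePoint ℂ) ↔ (1 + l) * z = 1 := by
  rcases eq_or_ne z 0 with rfl | hz
  · simp [invSubOne_zero]
  · rw [invSubOne_of_ne_zero hz, OnePoint.coe_eq_coe]
    refine ⟨fun h => ?_, fun h => ?_⟩
    · rw [← h, add_sub_cancel, inv_mul_cancel₀ hz]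
    · rw [inv_eq_of_mul_eq_one_left h, add_sub_cancel_left]

theorem invSubOne_injective : Function.Injective invSubOne := by
  intro z w h
  rcases eq_or_ne z 0 with rfl | hz
  · by_contra hw
    rw [invSubOne_zero, invSubOne_of_ne_zero (Ne.symm hw)] at h
    exact OnePoint.infty_ne_coe _ h
  · rcases eq_or_ne w 0 with rfl | hw
    · rw [invSubOne_zero, invSubOne_of_ne_zero hz] at h
      exact absurd h (OnePoint.coe_ne_infty _)
    · rw [invSubOne_of_ne_zero hz, invSubOne_of_ne_zero hw, OnePoint.coe_eq_coe] at h
      exact inv_injective (sub_left_injective h)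

theorem continuous_invSubOne : Continuous invSubOne := by
  refine continuous_iff_continuousAt.2 fun z => ?_
  rcases eq_or_ne z 0 with rfl | hz
  · rw [continuousAt_iff_punctured_nhds, invSubOne_zero]
    have h1 : Tendsto (fun z : ℂ => z⁻¹ - 1) (𝓝[≠] 0) (coclosedCompact ℂ) := by
      rw [coclosedCompact_eq_cocompact, ← Metric.cobounded_eq_cocompact]
      rw [← tendsto_norm_atTop_iff_cobounded]
      have h2 := (tendsto_norm_cobounded_atTop.comp
        (tendsto_inv₀_nhdsNE_zero (α := ℂ)))
      have h3 := tendsto_atTop_add_const_right _ (-1 : ℝ) h2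
      refine tendsto_atTop_mono (fun z => ?_) h3
      have := norm_sub_norm_le (z⁻¹) (1 : ℂ)
      simpa [sub_eq_add_neg] using this
    refine (OnePoint.tendsto_coe_infty.comp h1).congr' ?_
    filter_upwards [self_mem_nhdsWithin] with z hz
    exact (invSubOne_of_ne_zero hz).symm
  · have h1 : ContinuousAt (fun z : ℂ => ((z⁻¹ - 1 : ℂ) : OnePoint ℂ)) z :=
      OnePoint.continuous_coe.continuousAt.comp ((continuousAt_inv₀ hz).sub_const 1)
    refine h1.congr ?_
    filter_upwards [isOpen_ne.mem_nhds hz] with w hw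
    exact (invSubOne_of_ne_zero hw).symm

end Spectrum

/-! ### The spectrum of `a` in terms of the spectrum of `y`. -/

section SpectrumOfModel

variable {S : TauCompletion C X Λ} {a : X} {y : C} {hy : IsStarNormal y} {Y : Submodule ℂ X}
  {j : C(spectrum ℂ y, ℂ) →ₗ[ℂ] Y} {act : C(spectrum ℂ y, ℂ) →ₐ[ℂ] (Y →L[ℂ] Y)}

namespace IsCalculusModel

/-- As `t` acts injectively, `(l - a) f = 1` amounts to `f ((1 + l) t - 1) = t` in `C(K)`. This is
solvable exactly when the second factor has no zero, for at a zero it would force `t = 0`, where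
that factor is `-1`. -/
theorem coe_mem_spec_iff (h : IsCalculusModel S a hy j act) {l : ℂ} :
    (l : OnePoint ℂ) ∈ S.spec (StarAlgebra.elemental ℂ y) a ↔
      ∃ t : spectrum ℂ y, (1 + l) * (t : ℂ) = 1 := by
  obtain ⟨a', ha', hact⟩ := h.exists_act_eq
  have h0 : ((j 1 : Y) : X) = S.ι 1 := by rw [h.coe_apply, map_one]
  have e : ∀ f, act (idFun _) (act f (l • j 1 - a')) = j (f * ((1 + l) • idFun _ - 1)) := fun f => by
    rw [IsCalculusModule.act_comm, map_sub, map_smul, hact, h.act_apply, mul_one, ← map_smul,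
      ← map_sub, h.act_apply]
    congr 2
    ext t
    simp
    ring
  have h1 : (l : OnePoint ℂ) ∈ S.spec (StarAlgebra.elemental ℂ y) a ↔
      ¬ ∃ f, act f (l • j 1 - a') = j 1 := by
    have : (l : OnePoint ℂ) ∈ S.spec (StarAlgebra.elemental ℂ y) a ↔
        ¬ ∃ z, S.MulBy (StarAlgebra.elemental ℂ y) (l • S.ι 1 - a) z (S.ι 1) := by
      constructor
      · rintro (⟨l', hl, hz⟩ | ⟨hl, -⟩)
        · rw [OnePoint.coe_eq_coe] at hl; exact hl ▸ hz
        · exact absurd hl (OnePoint.coe_ne_infty _)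
      · exact fun hz => .inl ⟨l, rfl, hz⟩
    rw [this, not_iff_not]
    constructor
    · rintro ⟨z, hz⟩
      obtain ⟨b, f, hb, -, hf⟩ := h.mulBy_iff.1 hz
      obtain rfl : b = l • j 1 - a' := Subtype.coe_injective (by
        simp [hb, h0, ha'])
      exact ⟨f, Subtype.coe_injective (hf.trans h0.symm)⟩
    · rintro ⟨f, hf⟩
      exact ⟨_, h.mulBy_iff.2 ⟨l • j 1 - a', f, by simp [h0, ha'], rfl, by rw [hf, h0]⟩⟩
  rw [h1, not_iff_comm]
  constructor
  · intro ht
    push Not at ht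
    have hne : ∀ t : spectrum ℂ y, (1 + l) * (t : ℂ) - 1 ≠ 0 := fun t => sub_ne_zero.2 (ht t)
    let f : C(spectrum ℂ y, ℂ) := ⟨fun t => (t : ℂ) / ((1 + l) * (t : ℂ) - 1),
      continuous_subtype_val.div (by fun_prop) hne⟩
    refine ⟨f, ?_⟩
    have hf : f * ((1 + l) • idFun _ - 1) = idFun _ := by
      ext t
      exact div_mul_cancel₀ _ (hne t)
    have hi := h.act_idFun_pow_injective 1
    rw [pow_one] at hi
    refine hi ?_
    rw [e, hf, h.act_apply, mul_one]
  · rintro ⟨f, hf⟩ ⟨t, ht⟩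
    have h2 := e f
    rw [hf, h.act_apply, mul_one] at h2
    have h3 := DFunLike.congr_fun (h.injective h2) t
    simp only [ContinuousMap.mul_apply, ContinuousMap.sub_apply, ContinuousMap.smul_apply,
      idFun_apply, ContinuousMap.one_apply, smul_eq_mul, ht, sub_self, mul_zero] at h3
    rw [h3, mul_zero] at ht
    exact zero_ne_one ht

/-- Likewise `a = f` amounts to `t f = 1 - t`, which is solvable in `C(K)` exactly when `t` does not
vanish on `K`. -/
theorem infty_mem_spec_iff (h : IsCalculusModel S a hy j act) :
    OnePoint.infty ∈ S.spec (StarAlgebra.elemental ℂ y) a ↔ (0 : ℂ) ∈ spectrum ℂ y := by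
  obtain ⟨a', ha', hact⟩ := h.exists_act_eq
  have h1 : OnePoint.infty ∈ S.spec (StarAlgebra.elemental ℂ y) a ↔ ¬ ∃ f, j f = a' := by
    have : OnePoint.infty ∈ S.spec (StarAlgebra.elemental ℂ y) a ↔
        a ∉ S.ι '' (StarAlgebra.elemental ℂ y : Set C) := by
      constructor
      · rintro (⟨l', hl, -⟩ | ⟨-, hz⟩)
        · exact absurd hl (OnePoint.infty_ne_coe _)
        · exact hz
      · exact fun hz => .inr ⟨rfl, hz⟩
    rw [this, not_iff_not]
    constructor
    · rintro ⟨z, hz, hza⟩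
      obtain ⟨f, rfl⟩ := (mem_elemental_iff hy).1 hz
      exact ⟨f, Subtype.coe_injective ((h.coe_apply f).trans (hza.trans ha'.symm))⟩
    · rintro ⟨f, hf⟩
      exact ⟨_, (mem_elemental_iff hy).2 ⟨f, rfl⟩, by rw [← h.coe_apply, hf, ha']⟩
  rw [h1, not_iff_comm]
  constructor
  · intro h0
    have hne : ∀ t : spectrum ℂ y, (t : ℂ) ≠ 0 := fun t ht => h0 (ht ▸ t.2)
    let f : C(spectrum ℂ y, ℂ) := ⟨fun t => (1 - (t : ℂ)) / t,
      (continuous_const.sub continuous_subtype_val).div continuous_subtype_val hne⟩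
    have hf : idFun _ * f = 1 - idFun _ := by
      ext t
      exact mul_div_cancel₀ _ (hne t)
    refine ⟨f, ?_⟩
    have hi := h.act_idFun_pow_injective 1
    rw [pow_one] at hi
    refine hi ?_
    rw [h.act_apply, hf, hact]
  · rintro ⟨f, hf⟩ h0
    rw [← hf, h.act_apply] at hact
    have h3 := DFunLike.congr_fun (h.injective hact) ⟨0, h0⟩
    simp at h3

/-- The spectrum of `a` is homeomorphic to the spectrum of `(1 + a)⁻¹`. -/
theorem exists_homeomorph_spec (h : IsCalculusModel S a hy j act) :
    ∃ e : spectrum ℂ y ≃ₜ S.spec (StarAlgebra.elemental ℂ y) a,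
      ∀ t, (e t : OnePoint ℂ) = invSubOne t := by
  have hmem : ∀ t : spectrum ℂ y, invSubOne t ∈ S.spec (StarAlgebra.elemental ℂ y) a := fun t => by
    rcases eq_or_ne (t : ℂ) 0 with ht | ht
    · rw [ht, invSubOne_zero, h.infty_mem_spec_iff, ← ht]
      exact t.2
    · rw [invSubOne_of_ne_zero ht, h.coe_mem_spec_iff]
      exact ⟨t, by rw [add_sub_cancel, inv_mul_cancel₀ ht]⟩
  let φ : spectrum ℂ y → S.spec (StarAlgebra.elemental ℂ y) a := fun t => ⟨invSubOne t, hmem t⟩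
  have hφ : Function.Bijective φ := by
    refine ⟨fun t t' htt => Subtype.coe_injective
      (invSubOne_injective (congrArg Subtype.val htt)), ?_⟩
    rintro ⟨s, hs⟩
    induction s using OnePoint.rec with
    | infty =>
      exact ⟨⟨0, h.infty_mem_spec_iff.1 hs⟩, Subtype.ext invSubOne_zero⟩
    | coe l =>
      obtain ⟨t, ht⟩ := h.coe_mem_spec_iff.1 hs
      exact ⟨t, Subtype.ext (invSubOne_eq_coe_iff.2 ht)⟩
  have hc : Continuous (Equiv.ofBijective φ hφ) :=
    (continuous_invSubOne.comp continuous_subtype_val).subtype_mk _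
  exact ⟨hc.homeoOfEquivCompactToT2, fun t => rfl⟩

end IsCalculusModel

/-- The bounded continuous functions on a compact space, transported along a homeomorphism. -/
noncomputable def boundedPullback {α β : Type*} [TopologicalSpace α] [TopologicalSpace β]
    [CompactSpace α] (e : α ≃ₜ β) : (β →ᵇ ℂ) ≃⋆ₐ[ℂ] C(α, ℂ) :=
  have : CompactSpace β := e.compactSpace
  { toFun g := g.toContinuousMap.comp e
    invFun f := BoundedContinuousFunction.mkOfCompact (f.comp e.symm)
    left_inv g := by ext; simp
    right_inv f := by ext; simp
    map_mul' f g := rfl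
    map_add' f g := rfl
    map_star' f := rfl
    map_smul' c f := rfl }

theorem boundedPullback_apply {α β : Type*} [TopologicalSpace α] [TopologicalSpace β]
    [CompactSpace α] (e : α ≃ₜ β) (g : β →ᵇ ℂ) (t : α) : boundedPullback e g t = g (e t) := rfl

end SpectrumOfModel

/-! ### Functions of `λ` as functions of `t = 1 / (1 + λ)`. -/

section Representation

variable {σ : Set (OnePoint ℂ)} {K : Set ℂ}

/-- `f = (1 + l) ^ k g`, where `g` is a function of `t = 1 / (1 + l)`. -/
def Represents (k : ℕ) (f : FinPart σ → ℂ) (g : C(K, ℂ)) : Prop :=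
  ∀ (l : FinPart σ) (t : K), (1 + (l : ℂ)) * t = 1 → f l = (1 + (l : ℂ)) ^ k * g t

namespace Represents

theorem smul_add {k : ℕ} {f f' : FinPart σ → ℂ} {g g' : C(K, ℂ)} (h : Represents k f g)
    (h' : Represents k f' g') (c : ℂ) : Represents k (c • f + f') (c • g + g') := by
  intro l t hlt
  simp only [Pi.add_apply, Pi.smul_apply, ContinuousMap.add_apply, ContinuousMap.smul_apply,
    smul_eq_mul, h l t hlt, h' l t hlt]
  ring

theorem mul {k k' : ℕ} {f f' : FinPart σ → ℂ} {g g' : C(K, ℂ)} (h : Represents k f g)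
    (h' : Represents k' f' g') : Represents (k + k') (f * f') (g * g') := by
  intro l t hlt
  simp only [Pi.mul_apply, ContinuousMap.mul_apply, h l t hlt, h' l t hlt]
  ring

theorem star (hK : K ⊆ unitInterval) {k : ℕ} {f : FinPart σ → ℂ} {g : C(K, ℂ)}
    (h : Represents k f g) : Represents k (star f) (star g) := by
  intro l t hlt
  have hl : (starRingEnd ℂ) (1 + (l : ℂ)) = 1 + l := by
    obtain ⟨r, hr, hrt⟩ := hK t.2
    rw [← hrt] at hlt
    rw [← inv_eq_of_mul_eq_one_left hlt, map_inv₀, Complex.conj_ofReal]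
  simp only [Pi.star_apply, ContinuousMap.star_apply, h l t hlt, ← starRingEnd_apply,
    map_mul, map_pow, hl]

/-- Since `(1 + λ) t = 1`, the order can be increased at the cost of powers of `t`. This allows the
union over `k ≤ n` to be treated at the single order `n`. -/
theorem raise {k : ℕ} {f : FinPart σ → ℂ} {g : C(K, ℂ)} (h : Represents k f g) (m : ℕ) :
    Represents (k + m) f (idFun K ^ m * g) := by
  intro l t hlt
  have e : (1 + (l : ℂ)) ^ m * (t : ℂ) ^ m = 1 := by rw [← mul_pow, hlt, one_pow]
  simp only [ContinuousMap.mul_apply, ContinuousMap.pow_apply, idFun_apply, h l t hlt]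
  rw [pow_add, show (1 + (l : ℂ)) ^ k * (1 + (l : ℂ)) ^ m * ((t : ℂ) ^ m * g t) =
    (1 + (l : ℂ)) ^ k * g t * ((1 + (l : ℂ)) ^ m * (t : ℂ) ^ m) by ring, e, mul_one]

theorem one : Represents (K := K) 0 (fun _ : FinPart σ => (1 : ℂ)) 1 := fun l t _ => by simp

theorem id : Represents 1 (fun l : FinPart σ => (l : ℂ)) (1 - idFun K) := fun l t hlt => by
  rw [pow_one, ContinuousMap.sub_apply, mul_sub, idFun_apply, hlt, ContinuousMap.one_apply]
  ring

variable [CompactSpace K] {e : K ≃ₜ σ} (he : ∀ t, (e t : OnePoint ℂ) = invSubOne t)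
include he

theorem apply_homeomorph_eq {l : FinPart σ} {t : K} (hlt : (1 + (l : ℂ)) * t = 1) :
    e t = ⟨(l : OnePoint ℂ), l.2⟩ :=
  Subtype.ext ((he t).trans (invSubOne_eq_coe_iff.2 hlt))

theorem exists_mul_eq_one (l : FinPart σ) : ∃ t : K, (1 + (l : ℂ)) * t = 1 := by
  obtain ⟨t, ht⟩ := e.surjective ⟨(l : OnePoint ℂ), l.2⟩
  exact ⟨t, invSubOne_eq_coe_iff.1 ((he t).symm.trans (congrArg Subtype.val ht))⟩

/-- The point `t = 0` corresponds to `∞`, where `f` is not defined, so `f` determines `g` only off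
`0`. The factor `t` hides the value there. -/
theorem idFun_mul_eq {k : ℕ} {f : FinPart σ → ℂ} {g g' : C(K, ℂ)} (h : Represents k f g)
    (h' : Represents k f g') : idFun K * g = idFun K * g' := by
  ext t
  rcases eq_or_ne (t : ℂ) 0 with ht | ht
  · simp [ht]
  · have hl : (((t : ℂ)⁻¹ - 1 : ℂ) : OnePoint ℂ) ∈ σ := by
      rw [← invSubOne_of_ne_zero ht, ← he]; exact (e t).2
    have hlt : (1 + ((t : ℂ)⁻¹ - 1)) * t = 1 := by rw [add_sub_cancel, inv_mul_cancel₀ ht]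
    have hne : (1 + ((t : ℂ)⁻¹ - 1)) ^ k ≠ 0 := pow_ne_zero _ (left_ne_zero_of_mul_eq_one hlt)
    have := (h ⟨_, hl⟩ t hlt).symm.trans (h' ⟨_, hl⟩ t hlt)
    simp only [ContinuousMap.mul_apply, mul_left_cancel₀ hne this]

theorem congr_left {k : ℕ} {f f' : FinPart σ → ℂ} {g : C(K, ℂ)} (h : Represents k f g)
    (h' : Represents k f' g) : f = f' := by
  ext l
  obtain ⟨t, hlt⟩ := exists_mul_eq_one he l
  rw [h l t hlt, h' l t hlt]

theorem of_bounded (g : σ →ᵇ ℂ) :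
    Represents 0 (fun l : FinPart σ => g ⟨_, l.2⟩) (boundedPullback e g) := by
  intro l t hlt
  rw [pow_zero, one_mul, boundedPullback_apply, apply_homeomorph_eq he hlt]

theorem mem_Ck_iff {k : ℕ} {f : FinPart σ → ℂ} :
    f ∈ Ck σ k ↔ ∃ g : C(K, ℂ), Represents k f g := by
  constructor
  · rintro ⟨g, hg⟩
    refine ⟨boundedPullback e g, fun l t hlt => ?_⟩
    rw [hg l, boundedPullback_apply, apply_homeomorph_eq he hlt]
  · rintro ⟨g, hg⟩
    refine ⟨(boundedPullback e).symm g, fun l => ?_⟩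
    obtain ⟨t, hlt⟩ := exists_mul_eq_one he l
    rw [hg l t hlt, ← apply_homeomorph_eq he hlt, ← boundedPullback_apply,
      StarAlgEquiv.apply_symm_apply]

theorem mem_CkUnion {n k : ℕ} (hn : 1 ≤ n) (hk : k ≤ n) {f : FinPart σ → ℂ} {g : C(K, ℂ)}
    (h : Represents k f g) : f ∈ CkUnion σ n :=
  ⟨n, hn, le_rfl, (mem_Ck_iff he).2 ⟨_, by simpa [hk] using h.raise (n - k)⟩⟩

theorem exists_of_mem_CkUnion {n : ℕ} {f : FinPart σ → ℂ} (h : f ∈ CkUnion σ n) :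
    ∃ g : C(K, ℂ), Represents n f g := by
  obtain ⟨k, -, hk, hf⟩ := h
  obtain ⟨g, hg⟩ := (mem_Ck_iff he).1 hf
  exact ⟨_, by simpa [hk] using hg.raise (n - k)⟩

end Represents

end Representation

/-! ### Existence and uniqueness of the functional calculus. -/

section FunctionalCalculus

variable {S : TauCompletion C X Λ} {a : X} {y : C} {hy : IsStarNormal y} {Y : Submodule ℂ X}
  {j : C(spectrum ℂ y, ℂ) →ₗ[ℂ] Y} {act : C(spectrum ℂ y, ℂ) →ₐ[ℂ] (Y →L[ℂ] Y)}
  {e : spectrum ℂ y ≃ₜ S.spec (StarAlgebra.elemental ℂ y) a}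

/-- The isomorphism of the bounded continuous functions on the spectrum of `a` with the
`C*`-algebra that `y = (1 + a)⁻¹` generates. -/
noncomputable def boundedCalculus (hy : IsStarNormal y)
    (e : spectrum ℂ y ≃ₜ S.spec (StarAlgebra.elemental ℂ y) a) :
    (S.spec (StarAlgebra.elemental ℂ y) a →ᵇ ℂ) ≃⋆ₐ[ℂ] StarAlgebra.elemental ℂ y :=
  (boundedPullback e).trans (continuousFunctionalCalculus y)

theorem boundedCalculus_apply (hy : IsStarNormal y)
    (e : spectrum ℂ y ≃ₜ S.spec (StarAlgebra.elemental ℂ y) a)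
    (g : S.spec (StarAlgebra.elemental ℂ y) a →ᵇ ℂ) :
    (boundedCalculus hy e g : C) = cfcHom hy (boundedPullback e g) := by
  rw [cfcHom_eq_of_isStarNormal]; rfl

/-- `Φ f = (1 + a) ^ k g(y)` if `f = (1 + l) ^ k g`, expressed through `y ^ k Φ f = g(y)`. -/
def IsCalculusMap (n : ℕ) (j : C(spectrum ℂ y, ℂ) →ₗ[ℂ] Y)
    (act : C(spectrum ℂ y, ℂ) →ₐ[ℂ] (Y →L[ℂ] Y))
    (Φ : CkUnion (S.spec (StarAlgebra.elemental ℂ y) a) n → Y) : Prop :=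
  ∀ (f : CkUnion (S.spec (StarAlgebra.elemental ℂ y) a) n) (k : ℕ) (g : C(spectrum ℂ y, ℂ)), k ≤ n →
    Represents k (f : FinPart (S.spec (StarAlgebra.elemental ℂ y) a) → ℂ) g →
    act (idFun _ ^ k) (Φ f) = j g

variable {n : ℕ} {Φ : CkUnion (S.spec (StarAlgebra.elemental ℂ y) a) n → Y}

theorem IsCalculusMap.eq_of_act_eq (h : IsCalculusModel S a hy j act)
    (hΦ : IsCalculusMap n j act Φ) {f : CkUnion (S.spec (StarAlgebra.elemental ℂ y) a) n} {k : ℕ}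
    {g : C(spectrum ℂ y, ℂ)} (hk : k ≤ n)
    (hf : Represents k (f : FinPart (S.spec (StarAlgebra.elemental ℂ y) a) → ℂ) g) {b : Y}
    (hb : act (idFun _ ^ k) b = j g) : Φ f = b :=
  h.act_idFun_pow_injective k ((hΦ f k g hk hf).trans hb.symm)

theorem exists_isCalculusMap (h : IsCalculusModel S a hy j act)
    (he : ∀ t, (e t : OnePoint ℂ) = invSubOne t) {A : Submodule ℂ X} {c : Y}
    (hcA : (c : X) ∈ A) (hc : act (idFun _ ^ n) c = j 1) :
    ∃ Φ : CkUnion (S.spec (StarAlgebra.elemental ℂ y) a) n → Y, IsCalculusMap n j act Φ ∧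
      ∀ f, (Φ f : X) ∈ S.mulSpan A (StarAlgebra.elemental ℂ y) := by
  choose G hG using fun f : CkUnion (S.spec (StarAlgebra.elemental ℂ y) a) n =>
    Represents.exists_of_mem_CkUnion he f.2
  refine ⟨fun f => act (G f) c, fun f k g hk hf => ?_, fun f => ?_⟩
  · have h1 := (hG f).idFun_mul_eq he (by simpa [hk] using hf.raise (n - k))
    -- The power `n - k` brings `g` to the order `n` of `G f`; the additional factor `t` removes the
    -- ambiguity at `t = 0`.
    refine h.act_idFun_pow_injective (n - k + 1) ?_
    have e1 : idFun (spectrum ℂ y) ^ (n - k + 1) * idFun (spectrum ℂ y) ^ k =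
        idFun _ * idFun _ ^ n := by
      rw [← pow_add, ← pow_succ']; congr 1; omega
    rw [← IsCalculusModule.act_mul, e1, IsCalculusModule.act_comm, IsCalculusModule.act_mul, hc,
      h.act_apply, h.act_apply, h.act_apply, mul_one, mul_comm, h1, ← mul_assoc, pow_succ']
  · exact Submodule.subset_span ⟨c, hcA, cfcHom hy (G f), cfcHom_mem_elemental _ _,
      h.strongMul (G f) c⟩

/-- The involution of `X` is continuous and preserves `C*(a)`, hence preserves `Y`; its
compatibility with the action extends from `C(K)` by density. -/
theorem IsCalculusModel.exists_star (h : IsCalculusModel S a hy j act) (b : Y) :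
    ∃ b' : Y, (b' : X) = star (b : X) ∧ ∀ f, (act (star f) b' : X) = star (act f b : X) := by
  obtain ⟨F, hF, hb⟩ := h.exists_net b
  have hstar : ∀ f, (j (star f) : X) = star (j f : X) := fun f => by
    rw [h.coe_apply, h.coe_apply, map_star, S.ι_star]
  have h1 : Tendsto (fun g => (j (star g) : X)) F (𝓝 (star (b : X))) := by
    simp only [hstar]
    exact ((continuous_subtype_val.tendsto b).comp hb).star
  have hY : star (b : X) ∈ Y := h.isClosed.mem_of_tendsto h1 (.of_forall fun g => (j _).2)
  have h1' : Tendsto (fun g => j (star g)) F (𝓝 ⟨_, hY⟩) := tendsto_subtype_rng.2 h1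
  refine ⟨⟨_, hY⟩, rfl, fun f => ?_⟩
  have h2 := (continuous_subtype_val.tendsto _).comp
    (((act (star f)).continuous.tendsto _).comp h1')
  have h3 := ((continuous_subtype_val.tendsto _).comp
    (((act f).continuous.tendsto b).comp hb)).star
  refine tendsto_nhds_unique h2 (h3.congr fun g => ?_)
  simp only [Function.comp_apply, h.act_apply, ← hstar, star_mul']

theorem star_idFun {K : Set ℂ} (hK : K ⊆ unitInterval) : star (idFun K) = idFun K := by
  ext t
  obtain ⟨r, hr, hrt⟩ := hK t.2
  rw [ContinuousMap.star_apply, idFun_apply, ← hrt]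
  exact Complex.conj_ofReal r

theorem IsCalculusMap.isFunctionalCalculus (h : IsCalculusModel S a hy j act)
    (he : ∀ t, (e t : OnePoint ℂ) = invSubOne t) (hn : 1 ≤ n) {A : Submodule ℂ X} {c : ℕ → Y}
    (hc : ∀ k ≤ n, (c k : X) ∈ A ∧ act (idFun _ ^ k) (c k) = j 1) (hΦ : IsCalculusMap n j act Φ)
    (hΦA : ∀ f, (Φ f : X) ∈ S.mulSpan A (StarAlgebra.elemental ℂ y)) :
    IsFunctionalCalculus S A (StarAlgebra.elemental ℂ y) a n fun f => (Φ f : X) where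
  mem_mulSpan := hΦA
  injective f f' hff := by
    obtain ⟨g, hg⟩ := Represents.exists_of_mem_CkUnion he f.2
    obtain ⟨g', hg'⟩ := Represents.exists_of_mem_CkUnion he f'.2
    have h1 := hΦ f n g le_rfl hg
    rw [Subtype.coe_injective hff, hΦ f' n g' le_rfl hg'] at h1
    obtain rfl := h.injective h1
    exact Subtype.ext (hg.congr_left he hg')
  map_star f := by
    obtain ⟨g, hg⟩ := Represents.exists_of_mem_CkUnion he f.2
    have hs := hg.star h.subset
    refine ⟨hs.mem_CkUnion he hn le_rfl, ?_⟩
    obtain ⟨b', hb', hact⟩ := h.exists_star (Φ f)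
    rw [← hb']
    refine congrArg _ (hΦ.eq_of_act_eq h le_rfl hs (Subtype.coe_injective ?_))
    have h1 := hact (idFun _ ^ n)
    rw [star_pow, star_idFun h.subset, hΦ f n g le_rfl hg] at h1
    refine h1.trans ?_
    change _ = ((j (star g) : Y) : X)
    rw [h.coe_apply, h.coe_apply, map_star, S.ι_star]
  map_one := by
    refine ⟨Represents.one.mem_CkUnion he hn (Nat.zero_le n), ?_⟩
    rw [hΦ.eq_of_act_eq h (Nat.zero_le n) Represents.one (b := j 1) (by simp), h.coe_apply, map_one]
  map_id := by
    obtain ⟨a', ha', hact⟩ := h.exists_act_eq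
    refine ⟨Represents.id.mem_CkUnion he hn hn, ?_⟩
    rw [hΦ.eq_of_act_eq h hn Represents.id (b := a') (by rw [pow_one, hact]), ha']
  map_linear r f f' := by
    obtain ⟨g, hg⟩ := Represents.exists_of_mem_CkUnion he f.2
    obtain ⟨g', hg'⟩ := Represents.exists_of_mem_CkUnion he f'.2
    have hs := hg.smul_add hg' r
    refine ⟨hs.mem_CkUnion he hn le_rfl, ?_⟩
    rw [hΦ.eq_of_act_eq h le_rfl hs (b := r • Φ f + Φ f')
      (by rw [map_add, map_smul, hΦ f n g le_rfl hg, hΦ f' n g' le_rfl hg', map_add, map_smul])]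
    rfl
  map_mul k k' f f' hf hf' hkk := by
    obtain ⟨g, hg⟩ := (Represents.mem_Ck_iff he).1 hf
    obtain ⟨g', hg'⟩ := (Represents.mem_Ck_iff he).1 hf'
    have hs := hg.mul hg'
    obtain ⟨hcA, hck⟩ := hc k (by omega)
    obtain ⟨hcA', hck'⟩ := hc k' (by omega)
    obtain ⟨hcA'', hck''⟩ := hc (k + k') hkk
    -- This writes `f(a)` as `(1 + a) ^ m · g(y)`, the shape in which `ProdValue` multiplies.
    have key : ∀ (m : ℕ) (f : CkUnion _ n) (g : C(spectrum ℂ y, ℂ)), m ≤ n →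
        act (idFun _ ^ m) (c m) = j 1 → Represents m f.1 g → Φ f = act g (c m) :=
      fun m f g hm hcm hg => hΦ.eq_of_act_eq h hm hg (by
        rw [IsCalculusModule.act_comm, hcm, h.act_apply, mul_one])
    refine ⟨hs.mem_CkUnion he hn hkk, ⟨c k, c k', c (k + k'), cfcHom hy g, cfcHom hy g',
      h.leftMul_of_act_idFun_pow hck hck' hck'' hcA hcA' hcA'',
      h.mulBy_iff.2 ⟨c k, g, rfl, rfl, ?_⟩, h.mulBy_iff.2 ⟨c k', g', rfl, rfl, ?_⟩,
      h.mulBy_iff.2 ⟨c (k + k'), g * g', rfl, map_mul _ _ _, ?_⟩⟩, fun w hw => ?_⟩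
    · rw [key k f g (by omega) hck hg]
    · rw [key k' f' g' (by omega) hck' hg']
    · rw [key (k + k') ⟨_, hs.mem_CkUnion he hn hkk⟩ (g * g') hkk hck'' hs]
    · obtain ⟨u', v', w', hu, hv, rfl, hrs⟩ := h.prodValue hw
      obtain rfl := Subtype.coe_injective hu
      obtain rfl := Subtype.coe_injective hv
      refine congrArg _ (hΦ.eq_of_act_eq h hkk hs ?_).symm
      -- For any value `w` of the product, `t ^ k' v = g'` gives `t ^ k' w = g' u`, and then `t ^ k
      -- u = g` gives `t ^ (k + k') w = g g'`, which determines `w`.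
      rw [pow_add, IsCalculusModule.act_mul, hrs _ _ (hΦ f' k' g' (by omega) hg'),
        IsCalculusModule.act_comm, hΦ f k g (by omega) hg, h.act_apply, mul_comm]
  bounded := by
    refine ⟨boundedCalculus hy e, StarAlgEquiv.isometry _, fun g => ?_⟩
    have hs := Represents.of_bounded he g
    refine ⟨hs.mem_CkUnion he hn (Nat.zero_le n), ?_⟩
    rw [hΦ.eq_of_act_eq h (Nat.zero_le n) hs (b := j (boundedPullback e g)) (by simp), h.coe_apply,
      boundedCalculus_apply]

theorem IsCalculusMap.eq_of_isFunctionalCalculus (h : IsCalculusModel S a hy j act)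
    (he : ∀ t, (e t : OnePoint ℂ) = invSubOne t) (hn : 1 ≤ n) {A : Submodule ℂ X}
    (hΦ : IsCalculusMap n j act Φ)
    {Θ : CkUnion (S.spec (StarAlgebra.elemental ℂ y) a) n → X}
    (hΘ : IsFunctionalCalculus S A (StarAlgebra.elemental ℂ y) a n Θ) :
    Θ = fun f => (Φ f : X) := by
  obtain ⟨Ψ, hΨ, hΘΨ⟩ := hΘ.bounded
  obtain ⟨a', ha', hact⟩ := h.exists_act_eq
  have h0 : ((j 1 : Y) : X) = S.ι 1 := by rw [h.coe_apply, map_one]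
  have hprod : ∀ u v w, S.HasProd A (StarAlgebra.elemental ℂ y) u v w → ∀ s : C(spectrum ℂ y, ℂ),
      v = S.ι (cfcHom hy s) → ∃ u' w' : Y, (u' : X) = u ∧ (w' : X) = w ∧ w' = act s u' := by
    intro u v w huvw s hv
    obtain ⟨u', v', w', hu', hv', hw', hrs⟩ := h.prodValue huvw.1
    refine ⟨u', w', hu', hw', ?_⟩
    have hvs : v' = j s := Subtype.coe_injective (hv'.trans (hv.trans (h.coe_apply s).symm))
    simpa [IsCalculusModule.act_one] using hrs 1 s (by rw [IsCalculusModule.act_one, hvs])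
  -- The function `1 / (1 + λ)` on the spectrum of `a`, with value `0` at `∞`.
  let τ := (boundedPullback e).symm (idFun _)
  have hτ : boundedPullback e τ = idFun _ := StarAlgEquiv.apply_symm_apply _ _
  have hΨτ : (Ψ τ : C) = y := by
    obtain ⟨h1, hΘ1⟩ := hΘ.map_one
    obtain ⟨h2, hΘ2⟩ := hΘ.map_id
    obtain ⟨h3, hΘ3⟩ := hΘ.map_linear 1 ⟨_, h1⟩ ⟨_, h2⟩
    obtain ⟨h4, hΘ4⟩ := hΘΨ τ
    replace hΘ3 := hΘ3.trans (by rw [hΘ1, hΘ2, one_smul])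
    have hu : Represents (K := spectrum ℂ y) 1 ((1 : ℂ) • (fun _ : FinPart
        (S.spec (StarAlgebra.elemental ℂ y) a) => (1 : ℂ)) + fun l : FinPart
        (S.spec (StarAlgebra.elemental ℂ y) a) => (l : ℂ)) 1 := by
      intro l t _; simp
    have hv : Represents 0 (fun l : FinPart (S.spec (StarAlgebra.elemental ℂ y) a) =>
        τ ⟨_, l.2⟩) (idFun (spectrum ℂ y)) := hτ ▸ Represents.of_bounded he τ
    obtain ⟨h5, hΘ5⟩ := hΘ.map_mul 1 0 ⟨_, h3⟩ ⟨_, h4⟩ ((Represents.mem_Ck_iff he).2 ⟨_, hu⟩)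
      ((Represents.mem_Ck_iff he).2 ⟨_, hv⟩) (by omega)
    have hone : (⟨_, h5⟩ : CkUnion _ n) = ⟨_, h1⟩ := by
      refine Subtype.ext ((hu.mul hv).congr_left he ?_)
      simpa using Represents.one.raise 1
    obtain ⟨s, hs⟩ := (mem_elemental_iff hy).1 (Ψ τ).2
    rw [hone, hΘ1, hΘ3, hΘ4] at hΘ5
    obtain ⟨u', w', hu', hw', hsu⟩ := hprod _ _ _ hΘ5 s (by rw [hs])
    obtain rfl : u' = j 1 + a' := Subtype.coe_injective (by simp [hu', h0, ha'])
    obtain rfl : w' = j 1 := Subtype.coe_injective (hw'.trans h0.symm)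
    -- From `(1 + λ) τ = 1` one has `s (1 + a) = 1` in `Y`; multiplication by `t` turns this into `s
    -- = t`.
    have h6 := congrArg (act (idFun _)) hsu
    rw [IsCalculusModule.act_comm, map_add, hact, h.act_apply, mul_one, ← map_add,
      add_sub_cancel, h.act_apply, mul_one] at h6
    rw [← hs, ← h.injective h6]
    exact cfcHom_id hy
  -- Transported to `C*(a)`, both isomorphisms are continuous `*`-homomorphisms that agree at the
  -- generator `y`.
  have hΨeq : Ψ = boundedCalculus hy e := by
    have hb : boundedCalculus hy e τ = Ψ τ := Subtype.ext (by
      rw [boundedCalculus_apply, hτ, hΨτ]; exact cfcHom_id hy)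
    have hy' : Ψ τ = ⟨y, StarAlgebra.elemental.self_mem ℂ y⟩ := Subtype.ext hΨτ
    have hid : (boundedCalculus hy e).symm.trans Ψ =
        (boundedCalculus hy e).symm.trans (boundedCalculus hy e) := by
      refine StarAlgebra.elemental.starAlgHomClass_ext (R := ℂ) (a := y)
        (StarAlgEquiv.isometry _).continuous (StarAlgEquiv.isometry _).continuous ?_
      rw [← hy', ← hb, StarAlgEquiv.trans_apply, StarAlgEquiv.trans_apply,
        StarAlgEquiv.symm_apply_apply, hb]
    ext g
    have := DFunLike.congr_fun hid (boundedCalculus hy e g)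
    rw [StarAlgEquiv.trans_apply, StarAlgEquiv.trans_apply,
      StarAlgEquiv.symm_apply_apply] at this
    exact congrArg _ this
  ext f
  obtain ⟨g, hg⟩ := Represents.exists_of_mem_CkUnion he f.2
  -- With `ρ = (1 + λ) ^ (-n)` the product `f ρ` is the bounded function given by `g`.
  -- Multiplicativity then yields `t ^ n Θ f = g`, the equation that characterises `Φ f`.
  let ρ := (boundedPullback e).symm (idFun _ ^ n)
  have hρ : boundedPullback e ρ = idFun _ ^ n := StarAlgEquiv.apply_symm_apply _ _
  let η := (boundedPullback e).symm g
  have hη : boundedPullback e η = g := StarAlgEquiv.apply_symm_apply _ _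
  obtain ⟨h1, hΘ1⟩ := hΘΨ ρ
  obtain ⟨h2, hΘ2⟩ := hΘΨ η
  have hρ' := hρ ▸ Represents.of_bounded he ρ
  have hη' := hη ▸ Represents.of_bounded he η
  obtain ⟨h3, hΘ3⟩ := hΘ.map_mul n 0 f ⟨_, h1⟩ ((Represents.mem_Ck_iff he).2 ⟨_, hg⟩)
    ((Represents.mem_Ck_iff he).2 ⟨_, hρ'⟩) le_rfl
  have hfη : (⟨_, h3⟩ : CkUnion _ n) = ⟨_, h2⟩ := by
    refine Subtype.ext ((hg.mul hρ').congr_left he ?_)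
    simpa [mul_comm] using hη'.raise n
  rw [hfη, hΘ1, hΘ2, hΨeq, boundedCalculus_apply, boundedCalculus_apply, hρ, hη] at hΘ3
  obtain ⟨u', w', hu', hw', hsu⟩ := hprod _ _ _ hΘ3 _ rfl
  obtain rfl : w' = j g := Subtype.coe_injective (hw'.trans (h.coe_apply g).symm)
  rw [← hu', hΦ.eq_of_act_eq h le_rfl hg hsu.symm]

end FunctionalCalculus

end QuasiCStar

theorem theorem6p9 {C X Λ : Type*} [CStarAlgebra C] [PartialOrder C] [StarOrderedRing C]
    [AddCommGroup X] [Module ℂ X] [UniformSpace X] [IsUniformAddGroup X] [ContinuousSMul ℂ X]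
    [CompleteSpace X] [T2Space X] [StarAddMonoid X] [StarModule ℂ X] [ContinuousStar X]
    (S : QuasiCStar.TauCompletion C X Λ) (A : QuasiCStar.QuasiCStarNormedAlgebra S)
    (a : X) (haA : a ∈ A.carrier) (ha : a ∈ S.commQuasiPos) :
    (∃ y : C, S.IsInvOneAdd a y) ∧
    ∀ y : C, S.IsInvOneAdd a y → ∀ n : ℕ, 1 ≤ n →
      (∃ w, S.IsPow A.carrier (StarAlgebra.elemental ℂ y) a n w) →
      ∃! Φ : QuasiCStar.CkUnion (S.spec (StarAlgebra.elemental ℂ y) a) n → X,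
        QuasiCStar.IsFunctionalCalculus S A.carrier (StarAlgebra.elemental ℂ y) a n Φ := by
  refine ⟨QuasiCStar.TauCompletion.exists_isInvOneAdd A ha, fun y hinv n hn hpow => ?_⟩
  have hy : IsStarNormal y := (IsSelfAdjoint.of_nonneg (hinv.nonneg_norm_le A).1).isStarNormal
  obtain ⟨Y, j, act, h⟩ := QuasiCStar.exists_isCalculusModel A hinv hy
  obtain ⟨e, he⟩ := h.exists_homeomorph_spec
  obtain ⟨c, hc⟩ := h.exists_act_idFun_pow_eq_one A hpow
  obtain ⟨Φ, hΦ, hΦA⟩ := QuasiCStar.exists_isCalculusMap h he (hc n le_rfl).1 (hc n le_rfl).2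
  exact ⟨fun f => (Φ f : X), hΦ.isFunctionalCalculus h he hn hc hΦA,
    fun Θ hΘ => hΦ.eq_of_isFunctionalCalculus h he hn hΘ⟩
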